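/- **Graphs.** All graphs are finite, undirected and simple. A set $D\subseteq V(G)$ is dominating if every vertex of $G$ lies in $D$ or has a neighbour in $D$; $\gamma(G)$ is the minimum size of a dominating set; for real $\alpha$, a dominating set $D$ is an $\alpha$-approximation of a minimum dominating set if $|D|\le \alpha\,\gamma(G)$. A graph $H$ is a depth-$r$ minor of $G$ if there are pairwise vertex-disjoint connected subgraphs $G_v\subseteq G$ $(v\in V(H))$ of radius at most $r$ such that for every edge $uv$ of $H$ some edge of $G$ joins $G_u$ and $G_v$; $\nabla_r(G)$ is the maximum of $|E(H)|/|V(H)|$ over all depth-$r$ minors $H$ of $G$. A class $\mathcal C$ of graphs has sub-logarithmic expansion if there is a function $f:\mathbb N\to\mathbb N$ with $f(r)\in o(\log r)$ such that $\nabla_r(G)\le f(r)$ for all $G\in\mathcal C$ and all $r\in\mathbb N$. Finally, $\log^* n$ is the least $j$ such that applying $\log_2$ to $n$ iteratively $j$ times gives a value at most $1$. **Model.** In the LOCAL model every vertex of $G$ hosts an agent that initially knows only its own identifier and its local input (in particular it does not know $n=|V(G)|$). The agents run the same deterministic algorithm in synchronous rounds; in each round an agent sends one message to each neighbour through numbered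 ports, receives one message from each neighbour, and computes its new state. Message size and local computation are unrestricted. An agent terminates by fixing an output; after that its state does not change any more, and its neighbours keep seeing the message of its final state. The running time is the number of rounds until all agents have terminated. Identifiers are pairwise distinct natural numbers that are at most $n^k$ for some constant $k$, which the agents need not know. **Theorem.** Let $\mathcal C$ be a class of graphs of sub-logarithmic expansion. There is a deterministic distributed algorithm $\mathcal A$ in the LOCAL model such that for all real $c>0$, $\varepsilon>0$ and every $k\in\mathbb N$ there is a constant $K$ (depending only on $\mathcal C$, $c$, $\varepsilon$ and $k$) with the following property. Let $G\in\mathcal C$ be an $n$-vertex graph with any port numbering and any pairwise distinct identifiers at most $n^k$, and let $D$ be a $c$-approximation of a minimum dominating set of $G$. If every vertex receives as local input the numbers $c$ and $\varepsilon$ and the information whether it belongs to $D$, then all agents running $\mathcal A$ terminate within $K\cdot(1+\log^* n)$ rounds, that is, within $\mathcal O_{\varepsilon,c}(\log^* n)$ rounds, each with a yes/no output, and the set of vertices with output "yes" is a $(1+\varepsilon)$-approximation of a minimum dominating set of $G$. -/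

import Mathlib

universe u

/-! Shallow minors and sub-logarithmic expansion -/

/-- `H` is a depth-`r` minor of `G`: the vertices of `H` are modelled by pairwise vertex-disjoint
connected subgraphs of `G` of radius at most `r`, such that for every edge `ab` of `H` there is an
edge of `G` between the subgraphs modelling `a` and `b`. -/
def IsDepthMinor {W : Type*} {V : Type*} (r : ℕ) (H : SimpleGraph W) (G : SimpleGraph V) : Prop :=
  ∃ B : W → G.Subgraph,
    (∀ a, (B a).coe.Connected ∧ (B a).coe.radius ≤ (r : ℕ∞)) ∧
    (∀ a b, a ≠ b → Disjoint (B a).verts (B b).verts) ∧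
    (∀ a b, H.Adj a b → ∃ x ∈ (B a).verts, ∃ y ∈ (B b).verts, G.Adj x y)

/-- The set of edge densities `|E(H)| / |V(H)|` of the depth-`r` minors `H` of `G`. A minor of a
finite graph is finite, so it is enough to let `H` range over the graphs on `{0, …, m - 1}`. -/
def shallowDensities {V : Type*} (r : ℕ) (G : SimpleGraph V) : Set ℝ :=
  {d | ∃ (m : ℕ) (H : SimpleGraph (Fin m)), IsDepthMinor r H G ∧ d = (H.edgeSet.ncard : ℝ) / m}

/-- `∇_r(G)`, the maximal edge density of a depth-`r` minor of `G`. -/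
noncomputable def nabla {V : Type*} (r : ℕ) (G : SimpleGraph V) : ℝ :=
  sSup (shallowDensities r G)

/-- The number of vertices of a shallow minor is at most that of the host graph. -/
theorem IsDepthMinor.card_le {V : Type*} [Finite V] {r m : ℕ} {H : SimpleGraph (Fin m)}
    {G : SimpleGraph V} (h : IsDepthMinor r H G) : m ≤ Nat.card V := by
  obtain ⟨B, hB, hdisj, -⟩ := h
  have hne : ∀ a, ∃ x, x ∈ (B a).verts := fun a => by
    obtain ⟨x⟩ := (hB a).1.nonempty
    exact ⟨x.1, x.2⟩
  choose f hf using hne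
  have hinj : Function.Injective f := by
    intro a b hab
    by_contra hne
    exact Set.disjoint_left.mp (hdisj a b hne) (hf a) (hab ▸ hf b)
  simpa using Nat.card_le_card_of_injective f hinj

/-- On finite graphs the supremum in the definition of `∇_r` is a genuine one. -/
theorem shallowDensities_bddAbove {V : Type*} [Finite V] (r : ℕ) (G : SimpleGraph V) :
    BddAbove (shallowDensities r G) := by
  classical
  refine ⟨Nat.card V, ?_⟩
  rintro d ⟨m, H, hH, rfl⟩
  have hm := hH.card_le
  have he : H.edgeSet.ncard ≤ m * m := by
    have h1 := H.card_edgeFinset_le_card_choose_two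
    rw [Fintype.card_fin] at h1
    rw [← SimpleGraph.coe_edgeFinset, Set.ncard_coe_finset]
    refine h1.trans ?_
    rw [Nat.choose_two_right]
    exact (Nat.div_le_self _ _).trans (Nat.mul_le_mul_left _ (Nat.sub_le _ _))
  have he' : (H.edgeSet.ncard : ℝ) ≤ (m : ℝ) * m := by exact_mod_cast he
  have hm' : (m : ℝ) ≤ (Nat.card V : ℝ) := by exact_mod_cast hm
  exact (div_le_of_le_mul₀ (by positivity) (by positivity) he').trans hm'

/-- A class `C` of graphs has sub-logarithmic expansion if for some `f : ℕ → ℕ` with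
`f(r) ∈ o(log r)` every finite graph `G` in the class satisfies `∇_r(G) ≤ f(r)` for all `r`. -/
def HasSubLogExpansion (C : ∀ V : Type u, SimpleGraph V → Prop) : Prop :=
  ∃ f : ℕ → ℕ,
    (fun r : ℕ => (f r : ℝ)) =o[Filter.atTop] (fun r : ℕ => Real.log (r : ℝ)) ∧
    ∀ (V : Type u) [Finite V] (G : SimpleGraph V), C V G → ∀ r : ℕ, nabla r G ≤ (f r : ℝ)

/-! Dominating sets -/

/-- Every vertex lies in `D` or is adjacent to a vertex of `D`. -/
def IsDominatingSet {V : Type*} (G : SimpleGraph V) (D : Finset V) : Prop :=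
  ∀ v, v ∈ D ∨ ∃ w ∈ D, G.Adj w v

/-- `γ(G)`, the minimum size of a dominating set of a finite graph. -/
noncomputable def domNumber {V : Type*} (G : SimpleGraph V) : ℕ :=
  sInf {m | ∃ D : Finset V, IsDominatingSet G D ∧ D.card = m}

/-- `D` is an `α`-approximation of a minimum dominating set of `G`. -/
def IsApproxMDS {V : Type*} (G : SimpleGraph V) (α : ℝ) (D : Finset V) : Prop :=
  IsDominatingSet G D ∧ (D.card : ℝ) ≤ α * (domNumber G : ℝ)

/-! The iterated logarithm -/

/-- `0 ↦ 1`, `j + 1 ↦ 2 ^ (value at j)`. -/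
def powTower : ℕ → ℕ
  | 0 => 1
  | j + 1 => 2 ^ powTower j

/-- `log* n`, the least number `j` of applications of `log₂` to `n` after which the value is at
most `1`; equivalently, the least `j` such that `n` is at most the tower of `j` twos. -/
noncomputable def logStar (n : ℕ) : ℕ := sInf {j | n ≤ powTower j}

/-! The LOCAL model -/

/-- A numbering of the ports of every vertex: `nbrs v` lists the neighbours of `v`, each exactly
once, in the order of the ports of `v`. -/
structure PortNumbering {V : Type*} (G : SimpleGraph V) where
  nbrs : V → List V
  nodup : ∀ v, (nbrs v).Nodup
  mem_nbrs : ∀ v w, w ∈ nbrs v ↔ G.Adj v w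

/-- A deterministic distributed algorithm in the LOCAL model. Local computation and the size of
messages are unrestricted. An agent starts out knowing only its identifier and its local input
(`init`). In each round it sends one message through each of its ports (`send s p` for port `p`),
receives one message through each of its ports (listed in the order of its ports), and computes
its new state (`receive`). It terminates with output `b` when it reaches a state `s` with
`output s = some b`. -/
structure LocalAlgorithm (Input Output : Type) where
  State : Type
  Msg : Type
  init : ℕ → Input → State
  send : State → ℕ → Msg
  receive : State → List Msg → State
  output : State → Option Output

namespace LocalAlgorithm

variable {Input Output : Type} (A : LocalAlgorithm Input Output)

/-- One synchronous communication round. A terminated agent never changes its state again (its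
neighbours see the messages belonging to its final state). -/
def round {V : Type*} [DecidableEq V] {G : SimpleGraph V} (P : PortNumbering G)
    (s : V → A.State) : V → A.State := fun v =>
  match A.output (s v) with
  | some _ => s v
  | none => A.receive (s v) ((P.nbrs v).map fun w => A.send (s w) ((P.nbrs w).idxOf v))

/-- The states of the agents after `t` rounds, for identifiers `ident` and local inputs `inp`. -/
def run {V : Type*} [DecidableEq V] {G : SimpleGraph V} (P : PortNumbering G)
    (ident : V → ℕ) (inp : V → Input) (t : ℕ) : V → A.State :=
  (A.round P)^[t] (fun v => A.init (ident v) (inp v))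

/-- The result of vertex `v` after `t` rounds, `none` if it has not terminated by then. -/
def result {V : Type*} [DecidableEq V] {G : SimpleGraph V} (P : PortNumbering G)
    (ident : V → ℕ) (inp : V → Input) (t : ℕ) (v : V) : Option Output :=
  A.output (A.run P ident inp t v)

end LocalAlgorithm

/-- The local input of a vertex: whether it lies in the given dominating set, the approximation
factor of that set, and the accuracy parameter. -/
structure NodeInput where
  inD : Bool
  factor : ℝ
  eps : ℝ

/-!
The algorithm improves a given dominating set `D` by clustering and solving every cluster optimally.
The clusters are connected, have bounded radius, and start as the stars around the vertices of `D`.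
If an optimal dominating set is enlarged by the centres of all stars that touch another cluster,
it dominates every cluster from within, so the union of optimal solutions of the clusters has size
at most `γ(G)` plus the number of pairs of adjacent stars in different clusters
(`Network.card_selection_le`). It remains to make the number of such pairs at most `ε * γ(G)`.

Clusters are merged in rounds. Each cluster selects the neighbouring cluster to which it is joined
by most pairs of stars as its parent. The clusters after `i` rounds have radius at most `4 ^ i`
(`Network.linkedIn_leader`), so contracting them yields a shallow minor, which is degenerate by the
bound `f` on the expansion; hence the edges to the parents carry a fraction of order
`1 / f (4 ^ i)` of the total weight (`sum_weight_le_of_degenerate`). Every cluster becomes a centre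
or a satellite, and satellites whose parent is a centre join it. Derandomising fair coin flips by
conditional expectations merges along at least a quarter of the weight of the edges to the parents
(`sum_le_four_mul_sum_move`). So round `i` multiplies the weight by at most
`1 - 1 / (16 * max 1 (f (4 ^ i)))`.
Because `f (4 ^ i)` grows slower than `i`, the product of these factors tends to zero
(`tendsto_prod_one_sub_of_isLittleO`), and a constant number of rounds suffices.

The choices of side have to be made one after another along the edges to the parents, in an order
with few distinct time slots. As nothing is known about the size of the graph, the identifiers are
divided into `log*` many levels according to the number of steps of Cole–Vishkin colour reduction
that they need; the slot of a cluster consists of its level and of its colour, one of eight, among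
the clusters of its level. It differs from the slot of the parent (`slot_ne`).

All of this describes a clustering of the whole network that is defined without reference to
computation. The agents exchange all records of vertices that they have, and an agent stops when
its records determine its history, i.e. the development of its own cluster and of the neighbouring
clusters. An agent that has stopped no longer forwards further records. This does no harm, because
whatever an agent has to find out from others follows either from what its neighbours know or,
in case of an agent that has stopped, from its own history (`Network.IsGossip.entails_succ`), and
facts about a cluster belong to the histories of all of its members and so spread through it
(`Network.IsGossip.entails_of_linkedIn`). Therefore every round of merging takes a number of
communication rounds that is linear in the maximal level (`Network.IsGossip.settled`).
-/

open Filter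

/-! ### Colour reduction and levels of identifiers -/

/-- The least position at which the binary expansions of `x` and `y` differ. -/
noncomputable def firstDiff (x y : ℕ) : ℕ := sInf {i | x.testBit i ≠ y.testBit i}

/-- One step of Cole–Vishkin colour reduction: the first position at which the colour `x` differs
from the colour `y`, together with the bit of `x` at that position. -/
noncomputable def reduceColor (x y : ℕ) : ℕ :=
  2 * firstDiff x y + (x.testBit (firstDiff x y)).toNat

theorem testBit_firstDiff {x y : ℕ} (h : x ≠ y) :
    x.testBit (firstDiff x y) ≠ y.testBit (firstDiff x y) := by
  have : {i | x.testBit i ≠ y.testBit i}.Nonempty := by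
    by_contra hne
    rw [Set.not_nonempty_iff_eq_empty] at hne
    refine h (Nat.eq_of_testBit_eq fun i => ?_)
    by_contra hi
    exact (hne ▸ (show i ∈ {i | x.testBit i ≠ y.testBit i} from hi) : i ∈ (∅ : Set ℕ))
  exact Nat.sInf_mem this

theorem reduceColor_lt {x y m : ℕ} (h : x ≠ y) (hx : x < 2 ^ m) (hy : y < 2 ^ m) :
    reduceColor x y < 2 * m := by
  have hi : firstDiff x y < m := by
    by_contra hm
    push Not at hm
    refine testBit_firstDiff h ?_
    rw [Nat.testBit_lt_two_pow (hx.trans_le (Nat.pow_le_pow_right two_pos hm)),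
      Nat.testBit_lt_two_pow (hy.trans_le (Nat.pow_le_pow_right two_pos hm))]
  have hb := Bool.toNat_le (x.testBit (firstDiff x y))
  unfold reduceColor
  omega

/-- If the colours of `x` and of its parent differ, then so do the reduced colours, whatever colour
`z` the parent reduces its own colour against. -/
theorem reduceColor_ne {x y : ℕ} (hxy : x ≠ y) (z : ℕ) :
    reduceColor x y ≠ reduceColor y z := by
  intro h
  have h1 := Bool.toNat_le (x.testBit (firstDiff x y))
  have h2 := Bool.toNat_le (y.testBit (firstDiff y z))
  unfold reduceColor at h
  have h3 : firstDiff x y = firstDiff y z := by omega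
  have h4 : (x.testBit (firstDiff x y)).toNat = (y.testBit (firstDiff x y)).toNat := by
    rw [← h3] at h
    omega
  refine testBit_firstDiff hxy ?_
  revert h4
  cases x.testBit (firstDiff x y) <;> cases y.testBit (firstDiff x y) <;> simp

/-- The number of colours that remain when `j` further steps of colour reduction lead to eight
colours. -/
def palette : ℕ → ℕ
  | 0 => 8
  | j + 1 => 2 ^ (palette j / 2)

theorem eight_mul_powTower_le_palette (j : ℕ) : 8 * powTower j ≤ palette j := by
  induction j with
  | zero => simp [palette, powTower]
  | succ j ih =>
    have hpos : 1 ≤ powTower j := by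
      cases j with
      | zero => simp [powTower]
      | succ j => exact Nat.one_le_two_pow
    calc 8 * 2 ^ powTower j = 2 ^ (powTower j + 3) := by ring
      _ ≤ 2 ^ (palette j / 2) := Nat.pow_le_pow_right two_pos (by omega)

theorem lt_powTower (j : ℕ) : j < powTower j := by
  induction j with
  | zero => simp [powTower]
  | succ j ih => exact lt_of_le_of_lt ih Nat.lt_two_pow_self

theorem lt_palette (j : ℕ) : j < palette j := by
  have := lt_powTower j
  have := eight_mul_powTower_le_palette j
  omega

/-- The level of an identifier: the number of steps of colour reduction after which identifiers of
this size have become one of eight colours. -/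
noncomputable def level (x : ℕ) : ℕ := sInf {j | x < palette j}

theorem lt_palette_level (x : ℕ) : x < palette (level x) :=
  Nat.sInf_mem (s := {j | x < palette j}) ⟨x, lt_palette x⟩

theorem level_le {x j : ℕ} (h : x < palette j) : level x ≤ j := Nat.sInf_le h

theorem sq_le_eight_mul_two_pow (m : ℕ) (hm : 4 ≤ m) : (2 * m + 1) ^ 2 ≤ 8 * 2 ^ m := by
  induction m, hm using Nat.le_induction with
  | base => norm_num
  | succ m hm ih => rw [pow_succ 2 m]; nlinarith

/-- The palette outgrows every fixed power of the tower function at a bounded shift, so identifiers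
that are polynomial in the number of vertices have level `log* n + O(1)`. -/
theorem powTower_pow_lt_palette (j k : ℕ) : powTower j ^ k < palette (j + k) := by
  have hp := lt_powTower j
  induction k with
  | zero =>
    have := eight_mul_powTower_le_palette j
    simp; omega
  | succ k ih =>
    have h8 : 8 * powTower j ≤ palette (j + k) := by
      have hmono : powTower j ≤ powTower (j + k) := by
        clear ih
        induction k with
        | zero => simp
        | succ k ih =>
          exact ih.trans (by simpa [powTower, ← add_assoc] using Nat.lt_two_pow_self.le)
      exact (Nat.mul_le_mul_left 8 hmono).trans (eight_mul_powTower_le_palette _)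
    have hm : 4 ≤ palette (j + k) / 2 := by omega
    have hsq := sq_le_eight_mul_two_pow _ hm
    have hb : palette (j + k) ≤ 2 * (palette (j + k) / 2) + 1 := by omega
    change _ < 2 ^ (palette (j + k) / 2)
    have h1 : powTower j ^ (k + 1) < palette (j + k) * powTower j := by
      rw [pow_succ]
      exact Nat.mul_lt_mul_of_pos_right ih (by omega)
    nlinarith

theorem level_le_logStar_add {x n k : ℕ} (h : x ≤ n ^ k) : level x ≤ logStar n + k := by
  have hn : n ≤ powTower (logStar n) :=
    Nat.sInf_mem (s := {j | n ≤ powTower j}) ⟨n, (lt_powTower n).le⟩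
  exact level_le ((h.trans (Nat.pow_le_pow_left hn k)).trans_lt (powTower_pow_lt_palette _ _))

/-! ### Colouring a parent map -/

/-- The colour towards which the cluster `x` reduces its colour: that of its parent if the parent
has the same level, and an arbitrary different colour otherwise. -/
noncomputable def referenceColor (par : ℕ → ℕ) (c : ℕ → ℕ) (x : ℕ) : ℕ :=
  if par x ≠ x ∧ level (par x) = level x then c (par x) else if c x = 0 then 1 else 0

/-- The colour of `x` after `k` steps of colour reduction along the parent map `par`. Elements of
level `j` stop after `j` steps. -/
noncomputable def colorAt (par : ℕ → ℕ) : ℕ → ℕ → ℕ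
  | 0, x => x
  | k + 1, x =>
    if k < level x then reduceColor (colorAt par k x) (referenceColor par (colorAt par k) x)
    else colorAt par k x

theorem referenceColor_ne {par c : ℕ → ℕ} {x : ℕ}
    (h : par x ≠ x → level (par x) = level x → c x ≠ c (par x)) :
    c x ≠ referenceColor par c x := by
  unfold referenceColor
  split_ifs with h1 h2
  · exact h h1.1 h1.2
  · omega
  · exact h2

theorem colorAt_ne (par : ℕ → ℕ) (k : ℕ) :
    ∀ x, par x ≠ x → level (par x) = level x → colorAt par k x ≠ colorAt par k (par x) := by
  induction k with
  | zero => exact fun x h _ => h.symm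
  | succ k ih =>
    intro x h hl
    rw [colorAt, colorAt, hl]
    split_ifs
    · have h1 : referenceColor par (colorAt par k) x = colorAt par k (par x) := by
        rw [referenceColor, if_pos ⟨h, hl⟩]
      rw [h1]
      exact reduceColor_ne (ih x h hl) _
    · exact ih x h hl

theorem colorAt_lt_palette (par : ℕ → ℕ) (k : ℕ) :
    ∀ x, k ≤ level x → colorAt par k x < palette (level x - k) := by
  induction k with
  | zero => exact fun x _ => lt_palette_level x
  | succ k ih =>
    intro x hk
    obtain ⟨j, hj⟩ : ∃ j, level x = k + 1 + j := ⟨_, (Nat.add_sub_cancel' hk).symm⟩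
    have h0 : level x - (k + 1) = j := by omega
    have h1 : level x - k = j + 1 := by omega
    have hx := ih x (by omega)
    rw [colorAt, if_pos (by omega), h0]
    rw [h1] at hx
    have h8 : 8 ≤ palette j := by
      have := eight_mul_powTower_le_palette j
      have := lt_powTower j
      omega
    refine lt_of_lt_of_le (reduceColor_lt (m := palette j / 2)
      (referenceColor_ne (colorAt_ne par k x)) hx ?_) (by omega)
    unfold referenceColor
    split_ifs with h2
    · have := ih (par x) (by omega)
      rwa [h2.2, h1] at this
    · exact Nat.one_lt_two_pow (by omega)
    · positivity

theorem colorAt_of_level_le (par : ℕ → ℕ) {k x : ℕ} (h : level x ≤ k) :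
    colorAt par k x = colorAt par (level x) x := by
  induction k, h using Nat.le_induction with
  | base => rfl
  | succ k hk ih => rw [colorAt, if_neg (by omega), ih]

theorem colorAt_lt_eight (par : ℕ → ℕ) {k x : ℕ} (h : level x ≤ k) : colorAt par k x < 8 := by
  rw [colorAt_of_level_le par h]
  simpa [palette] using colorAt_lt_palette par (level x) x le_rfl

/-- The time at which `x` chooses its side: levels are scheduled one after another, and within a
level the eight final colours. -/
noncomputable def slot (par : ℕ → ℕ) (x : ℕ) : ℕ := 8 * level x + colorAt par (level x) x

theorem slot_ne (par : ℕ → ℕ) {x : ℕ} (h : par x ≠ x) : slot par x ≠ slot par (par x) := by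
  intro hs
  unfold slot at hs
  have h1 := colorAt_lt_eight par (le_refl (level x))
  have h2 := colorAt_lt_eight par (le_refl (level (par x)))
  have hl : level (par x) = level x := by omega
  refine colorAt_ne par (level x) x h hl ?_
  rw [hl] at hs
  omega

theorem slot_eq_iff (par : ℕ → ℕ) {x k : ℕ} :
    8 * level x + colorAt par k x = k ↔ slot par x = k := by
  unfold slot
  by_cases h : level x ≤ k
  · rw [colorAt_of_level_le par h]
  · constructor <;> intro h' <;> omega

/-! ### Choosing sides -/

/-- The sides of the clusters after `k` steps: `1` for a centre, `0` for a satellite, and `1 / 2`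
for a cluster that has not chosen yet. At its slot, a cluster `x` becomes a centre if the expected
weight of the satellites that it collects is at least the expected weight that it contributes as
a satellite of its parent, when undecided clusters are regarded as fair coin flips. -/
noncomputable def sideAt (wt : ℕ → ℕ → ℕ) (par : ℕ → ℕ) : ℕ → ℕ → ℝ
  | 0, _ => 1 / 2
  | k + 1, x =>
    if 8 * level x + colorAt par k x = k then
      if (wt x (par x) : ℝ) * sideAt wt par k (par x) ≤
          ∑ᶠ y, if par y = x then (wt x y : ℝ) * (1 - sideAt wt par k y) else 0
      then 1 else 0
    else sideAt wt par k x

section Sides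

variable (wt : ℕ → ℕ → ℕ) (par : ℕ → ℕ)

theorem sideAt_of_le_slot {k x : ℕ} (h : k ≤ slot par x) : sideAt wt par k x = 1 / 2 := by
  induction k with
  | zero => rfl
  | succ k ih => rw [sideAt, if_neg (by rw [slot_eq_iff]; omega), ih (by omega)]

theorem sideAt_of_slot_lt {k x : ℕ} (h : slot par x < k) :
    sideAt wt par k x = sideAt wt par (slot par x + 1) x := by
  induction k, (Nat.succ_le_of_lt h) using Nat.le_induction with
  | base => rfl
  | succ k hk ih => rw [sideAt, if_neg (by rw [slot_eq_iff]; omega), ih (by omega)]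

theorem sideAt_eq_zero_or_one {k x : ℕ} (h : slot par x < k) :
    sideAt wt par k x = 0 ∨ sideAt wt par k x = 1 := by
  rw [sideAt_of_slot_lt wt par h, sideAt, if_pos ((slot_eq_iff par).2 rfl)]
  split_ifs <;> simp

/-- The final side of the cluster `x`. -/
noncomputable def side (x : ℕ) : ℝ := sideAt wt par (8 * level x + 8) x

theorem slot_lt (x : ℕ) : slot par x < 8 * level x + 8 := by
  have := colorAt_lt_eight par (le_refl (level x))
  unfold slot
  omega

theorem sideAt_eq_side {k x : ℕ} (h : 8 * level x + 8 ≤ k) : sideAt wt par k x = side wt par x := by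
  have := slot_lt par x
  rw [side, sideAt_of_slot_lt wt par (by omega), sideAt_of_slot_lt wt par this]

/-- The leader of the new cluster to which the cluster `x` goes: satellites of a centre join it. -/
noncomputable def move (x : ℕ) : ℕ :=
  if side wt par x = 0 ∧ side wt par (par x) = 1 then par x else x

variable {wt par}

/-- The method of conditional expectations: the chosen sides do at least as well as independent
fair coin flips. -/
theorem sum_le_four_mul_sum_move (F : Finset ℕ) (hpar : ∀ x ∈ F, par x ∈ F)
    (hself : ∀ x, wt x x = 0) (hsymm : ∀ x y, wt x y = wt y x)
    (hsupp : ∀ x ∈ F, ∀ y, wt x y ≠ 0 → y ∈ F) :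
    ∑ x ∈ F, (wt x (par x) : ℝ) ≤ 4 * ∑ x ∈ F with move wt par x ≠ x, (wt x (par x) : ℝ) := by
  classical
  -- the expected weight of the edges from satellites to centres after `k` steps
  set Φ : ℕ → ℝ := fun k =>
    ∑ x ∈ F, (wt x (par x) : ℝ) * ((1 - sideAt wt par k x) * sideAt wt par k (par x)) with hΦ
  have hstep : ∀ k, Φ k ≤ Φ (k + 1) := by
    intro k
    set s := sideAt wt par k
    set δ : ℕ → ℝ := fun x => sideAt wt par (k + 1) x - s x with hδ
    have hδ0 : ∀ x, slot par x ≠ k → δ x = 0 := by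
      intro x hx
      simp only [hδ]
      rw [sideAt, if_neg (by rwa [slot_eq_iff]), sub_self]
    have hin : ∀ x ∈ F, (∑ᶠ y, if par y = x then (wt x y : ℝ) * (1 - s y) else 0)
        = ∑ y ∈ F with par y = x, (wt y (par y) : ℝ) * (1 - s y) := by
      intro x hx
      rw [finsum_eq_sum_of_support_subset (s := F), Finset.sum_filter]
      · refine Finset.sum_congr rfl fun y _ => ?_
        split_ifs with h
        · rw [h, hsymm]
        · rfl
      · intro y hy
        rw [Function.mem_support] at hy
        refine hsupp x hx y fun h0 => hy ?_
        simp [h0]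
    have hgain : ∀ x ∈ F, 0 ≤ δ x * ((∑ y ∈ F with par y = x, (wt y (par y) : ℝ) * (1 - s y))
        - (wt x (par x) : ℝ) * s (par x)) := by
      intro x hx
      by_cases hk : slot par x = k
      · have h2 : s x = 1 / 2 := sideAt_of_le_slot wt par hk.ge
        have h3 : δ x = (if (wt x (par x) : ℝ) * s (par x) ≤
            ∑ y ∈ F with par y = x, (wt y (par y) : ℝ) * (1 - s y) then 1 else 0) - 1 / 2 := by
          simp only [hδ]
          rw [sideAt, if_pos ((slot_eq_iff par).2 hk), hin x hx, h2]
        rw [h3]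
        split_ifs with h
        · exact mul_nonneg (by norm_num) (by linarith)
        · exact mul_nonneg_of_nonpos_of_nonpos (by norm_num) (by linarith)
      · rw [hδ0 x hk, zero_mul]
    have hdiff : Φ (k + 1) - Φ k = ∑ x ∈ F, δ x *
        ((∑ y ∈ F with par y = x, (wt y (par y) : ℝ) * (1 - s y))
          - (wt x (par x) : ℝ) * s (par x)) := by
      have hfib : ∑ x ∈ F, δ x * (∑ y ∈ F with par y = x, (wt y (par y) : ℝ) * (1 - s y))
          = ∑ y ∈ F, δ (par y) * ((wt y (par y) : ℝ) * (1 - s y)) := by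
        rw [← Finset.sum_fiberwise_of_maps_to hpar
          (fun y => δ (par y) * ((wt y (par y) : ℝ) * (1 - s y)))]
        refine Finset.sum_congr rfl fun x _ => ?_
        rw [Finset.mul_sum]
        refine Finset.sum_congr rfl fun y hy => ?_
        rw [(Finset.mem_filter.1 hy).2]
      have hsplit : ∑ x ∈ F, δ x * ((∑ y ∈ F with par y = x, (wt y (par y) : ℝ) * (1 - s y))
          - (wt x (par x) : ℝ) * s (par x)) = ∑ y ∈ F, (δ (par y) * ((wt y (par y) : ℝ) * (1 - s y))
          - δ y * ((wt y (par y) : ℝ) * s (par y))) := by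
        rw [Finset.sum_sub_distrib, ← hfib, ← Finset.sum_sub_distrib]
        exact Finset.sum_congr rfl fun x _ => mul_sub _ _ _
      rw [hsplit, hΦ]
      simp only
      rw [← Finset.sum_sub_distrib]
      refine Finset.sum_congr rfl fun x _ => ?_
      by_cases hx : par x = x
      · simp [hx, hself]
      -- `x` and its parent have different slots, so at most one of the two changes
      · have hprod : δ x * δ (par x) = 0 := by
          by_cases h1 : slot par x = k
          · rw [hδ0 (par x) (fun h2 => slot_ne par hx (h1.trans h2.symm)), mul_zero]
          · rw [hδ0 x h1, zero_mul]
        have e1 : sideAt wt par (k + 1) x = s x + δ x := by simp [hδ]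
        have e2 : sideAt wt par (k + 1) (par x) = s (par x) + δ (par x) := by simp [hδ]
        rw [e1, e2]
        linear_combination (-(wt x (par x) : ℝ)) * hprod
    linarith [hdiff ▸ Finset.sum_nonneg hgain]
  have hmono : Monotone Φ := monotone_nat_of_le_succ hstep
  have h0 : Φ 0 = (1 / 4) * ∑ x ∈ F, (wt x (par x) : ℝ) := by
    rw [hΦ, Finset.mul_sum]
    refine Finset.sum_congr rfl fun x _ => ?_
    simp only [sideAt]
    ring
  set k := F.sup (fun x => 8 * level x + 8)
  have hk : ∀ x ∈ F, sideAt wt par k x = side wt par x := fun x hx =>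
    sideAt_eq_side wt par (Finset.le_sup (f := fun x => 8 * level x + 8) hx)
  have hend : Φ k ≤ ∑ x ∈ F with move wt par x ≠ x, (wt x (par x) : ℝ) := by
    rw [hΦ, Finset.sum_filter]
    refine Finset.sum_le_sum fun x hx => ?_
    rw [hk x hx, hk _ (hpar x hx)]
    by_cases hx' : par x = x
    · simp [hx', hself]
    rcases sideAt_eq_zero_or_one wt par (slot_lt par x) with h1 | h1 <;>
    rcases sideAt_eq_zero_or_one wt par (slot_lt par (par x)) with h2 | h2 <;>
    · change side wt par _ = _ at h1 h2
      simp [move, h1, h2, hx']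
  have := hmono (Nat.zero_le k)
  linarith

end Sides

/-! ### Clusterings of a network -/

/-- A graph on the identifiers together with a set of marked vertices. Identifiers that do not occur
are isolated vertices. -/
structure Network where
  graph : SimpleGraph ℕ
  marked : Set ℕ

/-- What the members of a cluster see in their closed neighbourhoods: a tuple `(u, w, a, b, y)`
consists of a member `u`, of `w` with `w = u` or `w` adjacent to `u`, of the centres `a` and `b` of
the stars of `u` and `w`, and of the leader `y` of the cluster of `w`. -/
abbrev ClusterView := Set (ℕ × ℕ × ℕ × ℕ × ℕ)

/-- The number of pairs of stars, one in the cluster `x` with view `E` and one in the cluster `y`,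
that are joined by an edge. In an infinite network an infinite number is replaced by zero, which
affects no network of a finite graph. -/
noncomputable def ClusterView.weight (E : ClusterView) (x y : ℕ) : ℕ :=
  if y = x then 0 else {p : ℕ × ℕ | ∃ u w, (u, w, p.1, p.2, y) ∈ E}.ncard

open Classical in
/-- A neighbouring cluster of maximal weight, or `x` itself if there is none. -/
noncomputable def ClusterView.parent (E : ClusterView) (x : ℕ) : ℕ :=
  if h : ∃ y, 0 < E.weight x y ∧ ∀ z, E.weight x z ≤ E.weight x y then h.choose else x

/-- There is a walk of length at most `r` from `a` to `b` inside `S`. -/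
def LinkedIn {V : Type*} (G : SimpleGraph V) (S : Set V) (r : ℕ) (a b : V) : Prop :=
  ∃ p : G.Walk a b, p.length ≤ r ∧ ∀ u ∈ p.support, u ∈ S

namespace LinkedIn

variable {V : Type*} {G : SimpleGraph V} {S T : Set V} {r s : ℕ} {a b c : V}

theorem mono (h : LinkedIn G S r a b) (hS : S ⊆ T) (hr : r ≤ s) : LinkedIn G T s a b := by
  obtain ⟨p, h1, h2⟩ := h
  exact ⟨p, h1.trans hr, fun u hu => hS (h2 u hu)⟩

theorem refl (h : a ∈ S) : LinkedIn G S r a a := ⟨.nil, by simp, by simpa using h⟩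

theorem symm (h : LinkedIn G S r a b) : LinkedIn G S r b a := by
  obtain ⟨p, h1, h2⟩ := h
  exact ⟨p.reverse, by simpa using h1, by simpa using h2⟩

theorem trans (h : LinkedIn G S r a b) (h' : LinkedIn G S s b c) : LinkedIn G S (r + s) a c := by
  obtain ⟨p, h1, h2⟩ := h
  obtain ⟨q, h3, h4⟩ := h'
  refine ⟨p.append q, by rw [SimpleGraph.Walk.length_append]; omega, fun u hu => ?_⟩
  rw [SimpleGraph.Walk.mem_support_append_iff] at hu
  exact hu.elim (h2 u) (h4 u)

theorem of_adj (ha : a ∈ S) (hb : b ∈ S) (h : G.Adj a b) : LinkedIn G S 1 a b :=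
  ⟨h.toWalk, by simp, by simp [ha, hb]⟩

theorem left_mem (h : LinkedIn G S r a b) : a ∈ S := by
  obtain ⟨p, _, h2⟩ := h
  exact h2 _ p.start_mem_support

/-- Induction along a walk inside `S`. -/
theorem induction {P : ℕ → V → Prop} (h : LinkedIn G S r a b) (h0 : P 0 a)
    (hs : ∀ k u w, P k u → u ∈ S → w ∈ S → G.Adj u w → P (k + 1) w)
    (hmono : ∀ k u, P k u → P (k + 1) u) : P r b := by
  obtain ⟨p, h1, h2⟩ := h
  have key : ∀ (a b : V) (p : G.Walk a b) (k : ℕ), (∀ u ∈ p.support, u ∈ S) → P k a →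
      P (k + p.length) b := by
    intro a b p
    induction p with
    | nil => exact fun k _ h => h
    | @cons a c b hac q ih =>
      intro k hS h
      have h1 := ih (k + 1) (fun u hu => hS u (by simp [hu]))
        (hs k a c h (hS a (by simp)) (hS c (by simp)) hac)
      rw [SimpleGraph.Walk.length_cons]
      convert h1 using 1
      ring
  have hb := key a b p 0 h2 h0
  rw [zero_add] at hb
  obtain ⟨j, rfl⟩ := Nat.exists_eq_add_of_le h1
  clear h1
  induction j with
  | zero => exact hb
  | succ j ih => exact hmono _ _ ih

end LinkedIn

namespace Network

variable (I : Network)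

open Classical in
/-- The marked vertex to whose star `v` belongs. A vertex without marked vertices in its closed
neighbourhood forms a star of its own. -/
noncomputable def star (v : ℕ) : ℕ :=
  if v ∉ I.marked ∧ ∃ d, d ∈ I.marked ∧ I.graph.Adj v d then
    sInf {d | d ∈ I.marked ∧ I.graph.Adj v d} else v

theorem star_eq_or (v : ℕ) : I.star v = v ∨ I.star v ∈ I.marked ∧ I.graph.Adj v (I.star v) := by
  unfold star
  split_ifs with h
  · exact Or.inr (Nat.sInf_mem (s := {d | d ∈ I.marked ∧ I.graph.Adj v d}) h.2)
  · exact Or.inl rfl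

theorem star_of_marked {v : ℕ} (h : v ∈ I.marked) : I.star v = v := by
  unfold star
  rw [if_neg (by tauto)]

theorem star_star (v : ℕ) : I.star (I.star v) = I.star v := by
  rcases I.star_eq_or v with h | h
  · rw [h, h]
  · exact I.star_of_marked h.1

theorem star_mem {v : ℕ} (h : v ∈ I.marked ∨ ∃ d ∈ I.marked, I.graph.Adj v d) :
    I.star v ∈ I.marked := by
  by_cases hv : v ∈ I.marked
  · rwa [I.star_of_marked hv]
  · obtain ⟨d, hd, hvd⟩ := h.resolve_left hv
    unfold star
    rw [if_pos ⟨hv, d, hd, hvd⟩]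
    exact (Nat.sInf_mem (s := {d | d ∈ I.marked ∧ I.graph.Adj v d}) ⟨d, hd, hvd⟩).1

/-- The view of the cluster `x` of the clustering that assigns to every vertex its leader `ld`. -/
def viewOf (ld : ℕ → ℕ) (x : ℕ) : ClusterView :=
  {e | ld e.1 = x ∧ (e.1 = e.2.1 ∨ I.graph.Adj e.1 e.2.1) ∧ e.2.2.1 = I.star e.1 ∧
    e.2.2.2.1 = I.star e.2.1 ∧ e.2.2.2.2 = ld e.2.1}

/-- The leader of `v` in the clustering after `i` rounds of merging. Initially the clusters are the
stars around the marked vertices. -/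
noncomputable def leader : ℕ → ℕ → ℕ
  | 0 => I.star
  | i + 1 => fun v => move (fun x => (I.viewOf (leader i) x).weight x)
      (fun x => (I.viewOf (leader i) x).parent x) (leader i v)

/-- The view of the cluster with leader `x` after `i` rounds. -/
noncomputable def view (i x : ℕ) : ClusterView := I.viewOf (I.leader i) x

/-- The weight between the clusters `x` and `y` after `i` rounds. -/
noncomputable def wt (i x y : ℕ) : ℕ := (I.view i x).weight x y

/-- The heaviest neighbour of the cluster `x` after `i` rounds. -/
noncomputable def par (i x : ℕ) : ℕ := (I.view i x).parent x

theorem leader_zero (v : ℕ) : I.leader 0 v = I.star v := rfl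

theorem leader_succ (i v : ℕ) :
    I.leader (i + 1) v = move (I.wt i) (I.par i) (I.leader i v) := rfl

theorem mem_view {i x u w a b y : ℕ} : (u, w, a, b, y) ∈ I.view i x ↔
    I.leader i u = x ∧ (u = w ∨ I.graph.Adj u w) ∧ a = I.star u ∧ b = I.star w ∧
      y = I.leader i w := Iff.rfl

theorem wt_self (i x : ℕ) : I.wt i x x = 0 := by simp [wt, ClusterView.weight]

theorem wt_eq {i x y : ℕ} (h : x ≠ y) : I.wt i x y = {p : ℕ × ℕ | ∃ u w, I.leader i u = x ∧
    I.leader i w = y ∧ I.graph.Adj u w ∧ p.1 = I.star u ∧ p.2 = I.star w}.ncard := by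
  rw [wt, ClusterView.weight, if_neg h.symm]
  congr 1
  ext ⟨a, b⟩
  simp only [Set.mem_ofPred_eq, mem_view]
  refine exists_congr fun u => exists_congr fun w => ?_
  constructor
  · rintro ⟨h1, h2 | h2, h3, h4, h5⟩
    · exact absurd (h1 ▸ h2 ▸ h5.symm) h
    · exact ⟨h1, h5.symm, h2, h3, h4⟩
  · rintro ⟨h1, h2, h3, h4, h5⟩
    exact ⟨h1, Or.inr h3, h4, h5, h2.symm⟩

theorem wt_comm (i x y : ℕ) : I.wt i x y = I.wt i y x := by
  by_cases h : x = y
  · rw [h]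
  rw [I.wt_eq h, I.wt_eq (Ne.symm h), ← Set.ncard_image_of_injective _ Prod.swap_injective]
  congr 1
  ext ⟨a, b⟩
  simp only [Set.mem_image, Prod.exists, Prod.swap_prod_mk, Set.mem_ofPred_eq, Prod.mk.injEq]
  constructor
  · rintro ⟨_, _, ⟨u, w, h1, h2, h3, h4, h5⟩, rfl, rfl⟩
    exact ⟨w, u, h2, h1, h3.symm, h5, h4⟩
  · rintro ⟨u, w, h1, h2, h3, h4, h5⟩
    exact ⟨b, a, ⟨w, u, h2, h1, h3.symm, h5, h4⟩, rfl, rfl⟩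

theorem exists_adj_of_wt_ne_zero {i x y : ℕ} (h : I.wt i x y ≠ 0) :
    x ≠ y ∧ ∃ u w, I.leader i u = x ∧ I.leader i w = y ∧ I.graph.Adj u w := by
  have hxy : x ≠ y := by
    rintro rfl
    exact h (I.wt_self i x)
  rw [I.wt_eq hxy] at h
  obtain ⟨p, u, w, h1, h2, h3, -⟩ := Set.nonempty_of_ncard_ne_zero h
  exact ⟨hxy, u, w, h1, h2, h3⟩

theorem par_eq_or (i x : ℕ) :
    I.par i x = x ∨ (I.wt i x (I.par i x) ≠ 0 ∧ ∀ z, I.wt i x z ≤ I.wt i x (I.par i x)) := by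
  unfold par wt ClusterView.parent
  split_ifs with h
  · exact Or.inr ⟨h.choose_spec.1.ne', h.choose_spec.2⟩
  · exact Or.inl rfl

theorem move_eq_or (wt : ℕ → ℕ → ℕ) (par : ℕ → ℕ) (x : ℕ) :
    move wt par x = x ∨ move wt par x = par x ∧ side wt par (par x) = 1 := by
  unfold move
  split_ifs with h
  · exact Or.inr ⟨rfl, h.2⟩
  · exact Or.inl rfl

theorem move_of_side_eq_one {wt : ℕ → ℕ → ℕ} {par : ℕ → ℕ} {x : ℕ} (h : side wt par x = 1) :
    move wt par x = x := by
  unfold move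
  rw [if_neg]
  rintro ⟨h0, -⟩
  linarith

/-- Every cluster of the clustering after `i` rounds is connected, and its leader reaches all of its
members within the cluster by walks of length at most `4 ^ i`. -/
theorem linkedIn_leader (i : ℕ) : ∀ v,
    LinkedIn I.graph {u | I.leader i u = I.leader i v} (4 ^ i) (I.leader i v) v := by
  induction i with
  | zero =>
    intro v
    rcases I.star_eq_or v with h | h
    · rw [leader_zero, h]
      exact LinkedIn.refl h
    · exact LinkedIn.of_adj (I.star_star v) rfl h.2.symm
  | succ i ih =>
    intro v
    set x := I.leader i v with hx
    have hpow : 4 ^ i + (1 + (4 ^ i + 4 ^ i)) ≤ 4 ^ (i + 1) := by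
      have : 1 ≤ 4 ^ i := Nat.one_le_pow _ _ (by norm_num)
      rw [pow_succ]; omega
    rw [I.leader_succ i v, ← hx]
    have hsub : ∀ z, move (I.wt i) (I.par i) z = move (I.wt i) (I.par i) x →
        {u | I.leader i u = z} ⊆
        {u | I.leader (i + 1) u = move (I.wt i) (I.par i) x} := by
      intro z hz u (hu : I.leader i u = z)
      change I.leader (i + 1) u = _
      rw [leader_succ, hu, hz]
    rcases move_eq_or (I.wt i) (I.par i) x with h | ⟨h, h1⟩
    · have := (ih v).mono (hsub x rfl) (show 4 ^ i ≤ 4 ^ (i + 1) by omega)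
      rwa [h] at this ⊢
    · have h2 := move_of_side_eq_one h1
      rcases I.par_eq_or i x with h3 | h3
      · have := (ih v).mono (hsub x rfl) (show 4 ^ i ≤ 4 ^ (i + 1) by omega)
        rw [h, h3] at this ⊢
        exact this
      obtain ⟨hne, u, w, hu, hw, huw⟩ := I.exists_adj_of_wt_ne_zero h3.1
      have s1 := hsub x rfl
      have s2 := hsub (I.par i x) (by rw [h2, h])
      rw [h] at s1 s2 ⊢
      -- from the new leader to the joining edge `wu`, across it, to the old leader and on to `v`
      have l1 := (hw ▸ ih w).mono s2 le_rfl
      have l2 := LinkedIn.of_adj (s2 hw) (s1 hu) huw.symm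
      have l3 := (hu ▸ ih u).symm.mono s1 le_rfl
      have l4 := (ih v).mono s1 le_rfl
      exact (l1.trans (l2.trans (l3.trans l4))).mono subset_rfl hpow

theorem leader_leader (i v : ℕ) : I.leader i (I.leader i v) = I.leader i v :=
  (I.linkedIn_leader i v).left_mem

theorem leader_star (i v : ℕ) : I.leader i (I.star v) = I.leader i v := by
  induction i with
  | zero => exact I.star_star v
  | succ i ih => rw [leader_succ, leader_succ, ih]

/-- Two members of a cluster are joined inside the cluster. -/
theorem linkedIn_cluster {i u v : ℕ} (h : I.leader i u = I.leader i v) :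
    LinkedIn I.graph {w | I.leader i w = I.leader i v} (2 * 4 ^ i) u v := by
  have h1 := (I.linkedIn_leader i u).symm
  rw [h] at h1
  rw [two_mul]
  exact h1.trans (I.linkedIn_leader i v)

/-- `S` is a dominating set of the subgraph induced by the cluster with view `E`. The members of the
cluster are the `u` that occur with themselves as second entry. -/
def IsClusterSolution (E : ClusterView) (S : Finset ℕ) : Prop :=
  (∀ u ∈ S, ∃ a b y, (u, u, a, b, y) ∈ E) ∧
    ∀ u, (∃ a b y, (u, u, a, b, y) ∈ E) → ∃ w ∈ S, ∃ a b y, (w, u, a, b, y) ∈ E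

/-- A minimum dominating set of the subgraph induced by the cluster with view `E`. -/
noncomputable def clusterSolution (E : ClusterView) : Finset ℕ :=
  Classical.epsilon fun S => IsClusterSolution E S ∧ ∀ T, IsClusterSolution E T → S.card ≤ T.card

end Network

/-! ### The weight between clusters decreases -/

/-- If every nonempty subset of `F` has an element that is joined to at most `2 * d` others, then
the total weight is controlled by the heaviest weight at each element: remove such elements one by
one. -/
theorem sum_weight_le_of_degenerate {w : ℕ → ℕ → ℕ} {M : ℕ → ℝ} {d : ℝ}
    (hsymm : ∀ x y, w x y = w y x) (hself : ∀ x, w x x = 0) (hM : ∀ x y, (w x y : ℝ) ≤ M x)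
    (F : Finset ℕ)
    (hF : ∀ F' ⊆ F, F'.Nonempty → ∃ x ∈ F', ((F'.filter fun y => w x y ≠ 0).card : ℝ) ≤ 2 * d) :
    ∑ x ∈ F, ∑ y ∈ F, (w x y : ℝ) ≤ 4 * d * ∑ x ∈ F, M x := by
  induction F using Finset.strongInduction with
  | H F ih =>
    rcases F.eq_empty_or_nonempty with rfl | hne
    · simp
    obtain ⟨x, hx, hd⟩ := hF F subset_rfl hne
    have ih' := ih (F.erase x) (Finset.erase_ssubset hx)
      fun F' h => hF F' (h.trans (Finset.erase_subset _ _))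
    have hM0 : 0 ≤ M x := (Nat.cast_nonneg _).trans (hM x x)
    have hrow : ∑ y ∈ F.erase x, (w x y : ℝ) ≤ 2 * d * M x := by
      calc ∑ y ∈ F.erase x, (w x y : ℝ)
          ≤ ∑ y ∈ F, (w x y : ℝ) :=
            Finset.sum_le_sum_of_subset_of_nonneg (Finset.erase_subset _ _) (by intros; positivity)
        _ = ∑ y ∈ F with w x y ≠ 0, (w x y : ℝ) := by
            rw [Finset.sum_filter]
            refine Finset.sum_congr rfl fun y _ => ?_
            split_ifs with h
            · rfl
            · push Not at h
              simp [h]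
        _ ≤ ∑ y ∈ F with w x y ≠ 0, M x := Finset.sum_le_sum fun y _ => hM x y
        _ ≤ 2 * d * M x := by
            rw [Finset.sum_const, nsmul_eq_mul]
            exact mul_le_mul_of_nonneg_right hd hM0
    rw [← Finset.add_sum_erase F _ hx, ← Finset.add_sum_erase F M hx,
      ← Finset.add_sum_erase F (fun y => (w x y : ℝ)) hx]
    have hsplit : ∑ z ∈ F.erase x, ∑ y ∈ F, (w z y : ℝ) =
        ∑ z ∈ F.erase x, (w x z : ℝ) + ∑ z ∈ F.erase x, ∑ y ∈ F.erase x, (w z y : ℝ) := by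
      rw [← Finset.sum_add_distrib]
      refine Finset.sum_congr rfl fun z _ => ?_
      rw [← Finset.add_sum_erase F _ hx, hsymm z x]
    rw [hsplit, hself]
    push_cast
    nlinarith

namespace Network

variable (I : Network)

open Classical in
/-- The ordered pairs of stars that are joined by an edge and belong to different clusters after `i`
rounds. The finite set `U` is meant to contain all vertices that are not isolated. -/
noncomputable def crossing (U : Finset ℕ) (i : ℕ) : Finset (ℕ × ℕ) :=
  (U ×ˢ U).filter fun p => (∃ u w, I.graph.Adj u w ∧ p.1 = I.star u ∧ p.2 = I.star w) ∧
    I.leader i p.1 ≠ I.leader i p.2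

/-- The leaders of the clusters after `i` rounds. -/
noncomputable def leaders (U : Finset ℕ) (i : ℕ) : Finset ℕ := U.image (I.leader i)

variable {I} {U : Finset ℕ}

theorem star_mem_of_adj (hU : ∀ u w, I.graph.Adj u w → u ∈ U) {u : ℕ} (hu : u ∈ U) :
    I.star u ∈ U := by
  rcases I.star_eq_or u with h | h
  · rwa [h]
  · exact hU _ _ h.2.symm

theorem mem_crossing (hU : ∀ u w, I.graph.Adj u w → u ∈ U) {i : ℕ} {p : ℕ × ℕ} :
    p ∈ I.crossing U i ↔ (∃ u w, I.graph.Adj u w ∧ p.1 = I.star u ∧ p.2 = I.star w) ∧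
      I.leader i p.1 ≠ I.leader i p.2 := by
  simp only [crossing, Finset.mem_filter]
  rw [and_iff_right_iff_imp]
  rintro ⟨⟨u, w, h1, h2, h3⟩, -⟩
  rw [Finset.mem_product, h2, h3]
  exact ⟨star_mem_of_adj hU (hU _ _ h1), star_mem_of_adj hU (hU _ _ h1.symm)⟩

theorem leader_mem_leaders (hU : ∀ u w, I.graph.Adj u w → u ∈ U) {i u w : ℕ}
    (h : I.graph.Adj u w) : I.leader i u ∈ I.leaders U i :=
  Finset.mem_image_of_mem _ (hU u w h)

theorem mem_leaders_of_wt_ne_zero (hU : ∀ u w, I.graph.Adj u w → u ∈ U) {i x y : ℕ}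
    (h : I.wt i x y ≠ 0) : y ∈ I.leaders U i := by
  obtain ⟨-, u, w, -, rfl, huw⟩ := I.exists_adj_of_wt_ne_zero h
  exact leader_mem_leaders hU huw.symm

theorem par_mem_leaders (hU : ∀ u w, I.graph.Adj u w → u ∈ U) {i x : ℕ}
    (hx : x ∈ I.leaders U i) : I.par i x ∈ I.leaders U i := by
  rcases I.par_eq_or i x with h | h
  · rwa [h]
  · exact mem_leaders_of_wt_ne_zero hU h.1

open Classical in
theorem wt_eq_card_crossing (hU : ∀ u w, I.graph.Adj u w → u ∈ U) {i x y : ℕ} (hxy : x ≠ y) :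
    I.wt i x y =
      ((I.crossing U i).filter fun p => I.leader i p.1 = x ∧ I.leader i p.2 = y).card := by
  rw [I.wt_eq hxy, ← Set.ncard_coe_finset]
  congr 1
  ext ⟨a, b⟩
  simp only [Set.mem_ofPred_eq, Finset.coe_filter, mem_crossing hU]
  constructor
  · rintro ⟨u, w, rfl, rfl, h3, rfl, rfl⟩
    simp only [leader_star]
    exact ⟨⟨⟨u, w, h3, rfl, rfl⟩, hxy⟩, by simp⟩
  · rintro ⟨⟨⟨u, w, h3, rfl, rfl⟩, -⟩, h1, h2⟩
    rw [leader_star] at h1 h2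
    exact ⟨u, w, h1, h2, h3, rfl, rfl⟩

theorem card_crossing (hU : ∀ u w, I.graph.Adj u w → u ∈ U) (i : ℕ) :
    (I.crossing U i).card = ∑ x ∈ I.leaders U i, ∑ y ∈ I.leaders U i, I.wt i x y := by
  classical
  have hmaps : ∀ p ∈ I.crossing U i,
      (I.leader i p.1, I.leader i p.2) ∈ I.leaders U i ×ˢ I.leaders U i := by
    rintro ⟨a, b⟩ hp
    obtain ⟨⟨u, w, h1, h2, h3⟩, -⟩ := (mem_crossing hU).1 hp
    dsimp only at h2 h3 ⊢
    rw [h2, h3, leader_star, leader_star]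
    exact Finset.mem_product.2 ⟨leader_mem_leaders hU h1, leader_mem_leaders hU h1.symm⟩
  rw [Finset.card_eq_sum_card_fiberwise hmaps, Finset.sum_product]
  refine Finset.sum_congr rfl fun x _ => Finset.sum_congr rfl fun y _ => ?_
  by_cases h : x = y
  · rw [h, wt_self, Finset.card_eq_zero, Finset.filter_eq_empty_iff]
    intro p hp hpq
    rw [Prod.mk.injEq] at hpq
    exact ((mem_crossing hU).1 hp).2 (hpq.1.trans hpq.2.symm)
  · rw [wt_eq_card_crossing hU h]
    simp only [Prod.mk.injEq]

theorem wt_le_wt_par (hU : ∀ u w, I.graph.Adj u w → u ∈ U) (i x y : ℕ) :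
    I.wt i x y ≤ I.wt i x (I.par i x) := by
  rcases Nat.eq_zero_or_pos (I.wt i x y) with h0 | h0
  · omega
  obtain ⟨z, -, hz⟩ := Finset.exists_max_image (I.leaders U i) (I.wt i x)
    ⟨y, mem_leaders_of_wt_ne_zero hU h0.ne'⟩
  have hmax : ∀ z', I.wt i x z' ≤ I.wt i x z := by
    intro z'
    rcases Nat.eq_zero_or_pos (I.wt i x z') with h1 | h1
    · omega
    · exact hz _ (mem_leaders_of_wt_ne_zero hU h1.ne')
  have h : ∃ y, 0 < (I.view i x).weight x y ∧
      ∀ z, (I.view i x).weight x z ≤ (I.view i x).weight x y :=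
    ⟨z, h0.trans_le (hmax y), hmax⟩
  have hpar : I.par i x = h.choose := by
    rw [par, ClusterView.parent, dif_pos h]
  rw [hpar]
  exact h.choose_spec.2 y

/-- A satellite that joins its centre removes the weight between the two from the total. -/
theorem card_crossing_succ_add_le (hU : ∀ u w, I.graph.Adj u w → u ∈ U) (i : ℕ) :
    (I.crossing U (i + 1)).card +
      ∑ x ∈ I.leaders U i with move (I.wt i) (I.par i) x ≠ x, I.wt i x (I.par i x) ≤
      (I.crossing U i).card := by
  classical
  set m := move (I.wt i) (I.par i) with hm
  set A := (I.crossing U i).filter fun p => m (I.leader i p.1) ≠ I.leader i p.1 ∧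
    I.leader i p.2 = I.par i (I.leader i p.1) with hA
  have hsum : ∑ x ∈ I.leaders U i with m x ≠ x, I.wt i x (I.par i x) = A.card := by
    have hmaps : ∀ p ∈ A, I.leader i p.1 ∈ (I.leaders U i).filter fun x => m x ≠ x := by
      rintro ⟨a, b⟩ hp
      obtain ⟨hp, h1, -⟩ := Finset.mem_filter.1 hp
      obtain ⟨⟨u, w, h2, h3, -⟩, -⟩ := (mem_crossing hU).1 hp
      refine Finset.mem_filter.2 ⟨?_, h1⟩
      dsimp only at h3 ⊢
      rw [h3, leader_star]
      exact leader_mem_leaders hU h2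
    rw [Finset.card_eq_sum_card_fiberwise hmaps]
    refine Finset.sum_congr rfl fun x hx => ?_
    have hx' := (Finset.mem_filter.1 hx).2
    have hne : x ≠ I.par i x := by
      rcases move_eq_or (I.wt i) (I.par i) x with h | ⟨h, -⟩
      · exact absurd h hx'
      · rw [← h]
        exact hx'.symm
    rw [wt_eq_card_crossing hU hne, hA, Finset.filter_filter]
    congr 1
    refine Finset.filter_congr fun p _ => ?_
    constructor
    · rintro ⟨rfl, h⟩
      exact ⟨⟨hx', h⟩, rfl⟩
    · rintro ⟨⟨-, h⟩, rfl⟩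
      exact ⟨rfl, h⟩
  rw [hsum, ← Finset.card_union_of_disjoint]
  · refine Finset.card_le_card (Finset.union_subset (fun p hp => ?_) (Finset.filter_subset _ _))
    rw [mem_crossing hU] at hp ⊢
    refine ⟨hp.1, fun h => hp.2 ?_⟩
    rw [leader_succ, leader_succ, h]
  · rw [Finset.disjoint_left]
    intro p hp hpA
    obtain ⟨-, h1, h2⟩ := Finset.mem_filter.1 hpA
    refine ((mem_crossing hU).1 hp).2 ?_
    rcases move_eq_or (I.wt i) (I.par i) (I.leader i p.1) with h | ⟨h, h3⟩
    · exact absurd h h1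
    · rw [leader_succ, leader_succ, h, h2, move_of_side_eq_one h3]

/-- Every nonempty set of clusters after `i` rounds contains a cluster with at most `2 * d i`
neighbouring clusters in the set. -/
def IsSparse (I : Network) (U : Finset ℕ) (d : ℕ → ℝ) : Prop :=
  ∀ i, ∀ F ⊆ I.leaders U i, F.Nonempty →
    ∃ x ∈ F, ((F.filter fun y => I.wt i x y ≠ 0).card : ℝ) ≤ 2 * d i

theorem card_crossing_zero_le (hU : ∀ u w, I.graph.Adj u w → u ∈ U) {d : ℕ → ℝ}
    (hd : I.IsSparse U d) :
    ((I.crossing U 0).card : ℝ) ≤ 4 * d 0 * (I.leaders U 0).card := by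
  have hone : ∀ x y, (I.wt 0 x y : ℝ) ≤ 1 := by
    classical
    intro x y
    by_cases hxy : x = y
    · simp [hxy, wt_self]
    rw [wt_eq_card_crossing hU hxy, Nat.cast_le_one]
    refine (Finset.card_le_card (t := {(x, y)}) ?_).trans (by simp)
    rintro ⟨a, b⟩ hp
    obtain ⟨hp, h1, h2⟩ := Finset.mem_filter.1 hp
    obtain ⟨⟨u, w, -, h3, h4⟩, -⟩ := (mem_crossing hU).1 hp
    dsimp only at h1 h2 h3 h4
    rw [leader_zero, h3, star_star, ← h3] at h1
    rw [leader_zero, h4, star_star, ← h4] at h2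
    simp [h1, h2]
  have := sum_weight_le_of_degenerate (I.wt_comm 0) (I.wt_self 0) hone _ (hd 0)
  rw [card_crossing hU]
  push_cast
  simpa using this

theorem card_crossing_succ_le (hU : ∀ u w, I.graph.Adj u w → u ∈ U) {d : ℕ → ℝ}
    (hd : I.IsSparse U d) (hd1 : ∀ i, 1 ≤ d i) (i : ℕ) :
    ((I.crossing U (i + 1)).card : ℝ) ≤ (1 - 1 / (16 * d i)) * (I.crossing U i).card := by
  have h1 := sum_weight_le_of_degenerate (I.wt_comm i) (I.wt_self i)
    (M := fun x => (I.wt i x (I.par i x) : ℝ))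
    (fun x y => by exact_mod_cast wt_le_wt_par hU i x y) _ (hd i)
  have h2 := sum_le_four_mul_sum_move (wt := I.wt i) (par := I.par i) (I.leaders U i)
    (fun x hx => par_mem_leaders hU hx) (I.wt_self i) (I.wt_comm i)
    (fun x _ y h => mem_leaders_of_wt_ne_zero hU h)
  have h3 : ((I.crossing U (i + 1)).card : ℝ) +
      ∑ x ∈ I.leaders U i with move (I.wt i) (I.par i) x ≠ x, (I.wt i x (I.par i x) : ℝ) ≤
      (I.crossing U i).card := by exact_mod_cast card_crossing_succ_add_le hU i
  have h4 : ((I.crossing U i).card : ℝ) =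
      ∑ x ∈ I.leaders U i, ∑ y ∈ I.leaders U i, (I.wt i x y : ℝ) := by
    exact_mod_cast card_crossing hU i
  have hpos : 0 < d i := by linarith [hd1 i]
  rw [← h4] at h1
  have h5 : 1 / (16 * d i) * (I.crossing U i).card ≤
      ∑ x ∈ I.leaders U i with move (I.wt i) (I.par i) x ≠ x, (I.wt i x (I.par i x) : ℝ) := by
    rw [one_div, inv_mul_le_iff₀ (by positivity)]
    nlinarith
  linarith

theorem card_crossing_le (hU : ∀ u w, I.graph.Adj u w → u ∈ U) {d : ℕ → ℝ}
    (hd : I.IsSparse U d) (hd1 : ∀ i, 1 ≤ d i) (i : ℕ) :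
    ((I.crossing U i).card : ℝ) ≤
      (∏ j ∈ Finset.range i, (1 - 1 / (16 * d j))) * (4 * d 0 * (I.leaders U 0).card) := by
  induction i with
  | zero => simpa using card_crossing_zero_le hU hd
  | succ i ih =>
    refine (card_crossing_succ_le hU hd hd1 i).trans ?_
    have h0 : (0 : ℝ) ≤ 1 - 1 / (16 * d i) := by
      have h1 := hd1 i
      rw [sub_nonneg, div_le_one (by positivity)]
      linarith
    rw [Finset.prod_range_succ, mul_comm _ (1 - 1 / (16 * d i)), mul_assoc]
    exact mul_le_mul_of_nonneg_left ih h0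

end Network

namespace Network

variable {I : Network} {U : Finset ℕ}

/-! ### Solving the clusters optimally -/

theorem clusterSolution_spec {E : ClusterView} (h : ∃ S, IsClusterSolution E S) :
    IsClusterSolution E (clusterSolution E) ∧
      ∀ T, IsClusterSolution E T → (clusterSolution E).card ≤ T.card := by
  have hmin : ∃ S, IsClusterSolution E S ∧ ∀ T, IsClusterSolution E T → S.card ≤ T.card := by
    obtain ⟨S, hS, hle⟩ := (measure Finset.card).wf.has_min {S | IsClusterSolution E S} h
    exact ⟨S, hS, fun T hT => not_lt.1 (hle T hT)⟩
  exact Classical.epsilon_spec hmin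

theorem exists_mem_view_iff {i x u w : ℕ} : (∃ a b y, (u, w, a, b, y) ∈ I.view i x) ↔
    I.leader i u = x ∧ (u = w ∨ I.graph.Adj u w) := by
  constructor
  · rintro ⟨a, b, y, h1, h2, -⟩
    exact ⟨h1, h2⟩
  · rintro ⟨h1, h2⟩
    exact ⟨I.star u, I.star w, I.leader i w, h1, h2, rfl, rfl, rfl⟩

theorem mem_of_leader_mem_leaders (hU : ∀ u w, I.graph.Adj u w → u ∈ U) {i u : ℕ}
    (h : I.leader i u ∈ I.leaders U i) : u ∈ U := by
  obtain ⟨v, hv, hvu⟩ := Finset.mem_image.1 h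
  obtain ⟨p, -, -⟩ := I.linkedIn_cluster hvu.symm
  cases p with
  | nil => exact hv
  | cons hadj _ => exact hU _ _ hadj

open Classical in
/-- The vertices selected by optimal solutions of the clusters after `i` rounds. -/
noncomputable def selection (I : Network) (U : Finset ℕ) (i : ℕ) : Finset ℕ :=
  U.filter fun v => v ∈ clusterSolution (I.view i (I.leader i v))

open Classical in
/-- An optimal dominating set, together with the centres of all stars that touch another cluster,
dominates every cluster from within. -/
theorem isClusterSolution_filter (hU : ∀ u w, I.graph.Adj u w → u ∈ U) {O : Finset ℕ}
    (hO : ∀ u ∈ U, ∃ o ∈ O, o = u ∨ I.graph.Adj o u) {i x : ℕ} (hx : x ∈ I.leaders U i) :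
    IsClusterSolution (I.view i x)
      ((O ∪ (I.crossing U i).image Prod.fst).filter fun v => I.leader i v = x) := by
  simp only [IsClusterSolution, exists_mem_view_iff]
  refine ⟨fun u hu => ⟨(Finset.mem_filter.1 hu).2, by simp⟩, ?_⟩
  rintro u ⟨rfl, -⟩
  obtain ⟨o, ho, hou⟩ := hO u (mem_of_leader_mem_leaders hU hx)
  by_cases hl : I.leader i o = I.leader i u
  · exact ⟨o, Finset.mem_filter.2 ⟨Finset.mem_union_left _ ho, hl⟩, hl, hou⟩
  · have hadj : I.graph.Adj u o := by
      rcases hou with rfl | h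
      · exact absurd rfl hl
      · exact h.symm
    -- `u` is dominated only from outside of its cluster, so the centre of its star has been added
    refine ⟨I.star u, Finset.mem_filter.2 ⟨Finset.mem_union_right _ (Finset.mem_image.2
      ⟨(I.star u, I.star o), ?_, rfl⟩), I.leader_star i u⟩, I.leader_star i u, ?_⟩
    · rw [mem_crossing hU]
      refine ⟨⟨u, o, hadj, rfl, rfl⟩, ?_⟩
      dsimp only
      rw [leader_star, leader_star]
      exact Ne.symm hl
    · rcases I.star_eq_or u with h | h
      · exact Or.inl h
      · exact Or.inr h.2.symm

theorem exists_mem_selection (hU : ∀ u w, I.graph.Adj u w → u ∈ U) (i : ℕ) {u : ℕ} (hu : u ∈ U) :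
    ∃ w ∈ I.selection U i, w = u ∨ I.graph.Adj w u := by
  classical
  have hx : I.leader i u ∈ I.leaders U i := Finset.mem_image_of_mem _ hu
  have hsol := (clusterSolution_spec ⟨_, isClusterSolution_filter hU (O := U)
    (fun u hu => ⟨u, hu, Or.inl rfl⟩) hx⟩).1
  obtain ⟨w, hw, hwu⟩ := hsol.2 u (exists_mem_view_iff.2 ⟨rfl, Or.inl rfl⟩)
  rw [exists_mem_view_iff] at hwu
  refine ⟨w, Finset.mem_filter.2 ⟨mem_of_leader_mem_leaders hU (hwu.1 ▸ hx), ?_⟩, hwu.2⟩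
  rwa [hwu.1]

/-- Solving each cluster optimally costs at most one additional vertex per crossing pair of
stars. -/
theorem card_selection_le (hU : ∀ u w, I.graph.Adj u w → u ∈ U) (i : ℕ) {O : Finset ℕ}
    (hO : ∀ u ∈ U, ∃ o ∈ O, o = u ∨ I.graph.Adj o u) :
    (I.selection U i).card ≤ O.card + (I.crossing U i).card := by
  classical
  set T := O ∪ (I.crossing U i).image Prod.fst
  calc (I.selection U i).card
      ≤ ((I.leaders U i).biUnion fun x => clusterSolution (I.view i x)).card := by
        refine Finset.card_le_card fun v hv => ?_
        obtain ⟨hv, hs⟩ := Finset.mem_filter.1 hv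
        exact Finset.mem_biUnion.2 ⟨_, Finset.mem_image_of_mem _ hv, hs⟩
    _ ≤ ∑ x ∈ I.leaders U i, (clusterSolution (I.view i x)).card := Finset.card_biUnion_le
    _ ≤ ∑ x ∈ I.leaders U i, (T.filter fun v => I.leader i v = x).card := by
        refine Finset.sum_le_sum fun x hx => ?_
        have hT := isClusterSolution_filter hU hO hx
        exact (clusterSolution_spec ⟨_, hT⟩).2 _ hT
    _ = (T.filter fun v => I.leader i v ∈ I.leaders U i).card := by
        have hmaps : ∀ v ∈ T.filter fun v => I.leader i v ∈ I.leaders U i,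
            I.leader i v ∈ I.leaders U i := fun v hv => (Finset.mem_filter.1 hv).2
        rw [Finset.card_eq_sum_card_fiberwise hmaps]
        refine Finset.sum_congr rfl fun x hx => ?_
        rw [Finset.filter_filter]
        congr 1
        refine Finset.filter_congr fun v _ => ?_
        constructor
        · rintro rfl
          exact ⟨hx, rfl⟩
        · exact fun h => h.2
    _ ≤ T.card := Finset.card_filter_le _ _
    _ ≤ O.card + (I.crossing U i).card :=
        (Finset.card_union_le _ _).trans (Nat.add_le_add_left Finset.card_image_le _)

/-! ### Sub-logarithmic expansion -/

/-- The network of a graph whose vertices carry identifiers. -/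
def ofGraph {V : Type*} (e : V ↪ ℕ) (G : SimpleGraph V) (D : Set V) : Network :=
  ⟨G.map e, e '' D⟩

theorem ofGraph_adj {V : Type*} {e : V ↪ ℕ} {G : SimpleGraph V} {D : Set V} {v : V} {j : ℕ} :
    (ofGraph e G D).graph.Adj (e v) j ↔ ∃ w, G.Adj v w ∧ e w = j := by
  change (G.map e).Adj _ _ ↔ _
  constructor
  · intro h
    obtain ⟨a, b, hab, ha, rfl⟩ := (SimpleGraph.map_adj _ _ _ _).1 h
    exact ⟨b, e.injective ha ▸ hab, rfl⟩
  · rintro ⟨w, hw, rfl⟩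
    exact (SimpleGraph.map_adj _ _ _ _).2 ⟨v, w, hw, rfl, rfl⟩

theorem _root_.LinkedIn.of_map {V : Type*} {e : V ↪ ℕ} {G : SimpleGraph V} {S : Set ℕ} {r : ℕ}
    {a : V} {b : ℕ} (h : LinkedIn (G.map e) S r (e a) b) :
    ∃ c, e c = b ∧ LinkedIn G (e ⁻¹' S) r a c := by
  refine LinkedIn.induction (P := fun k b => ∃ c, e c = b ∧ LinkedIn G (e ⁻¹' S) k a c) h
    ⟨a, rfl, LinkedIn.refl h.left_mem⟩ ?_ ?_
  · rintro k u w ⟨c, rfl, hc⟩ hu hw hadj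
    obtain ⟨c', d, hcd, hc', rfl⟩ := (SimpleGraph.map_adj _ _ _ _).1 hadj
    obtain rfl := e.injective hc'
    exact ⟨d, rfl, hc.trans (LinkedIn.of_adj hu hw hcd)⟩
  · rintro k u ⟨c, hc, h⟩
    exact ⟨c, hc, h.mono subset_rfl k.le_succ⟩

theorem _root_.LinkedIn.exists_walk_coe_induce {V : Type*} {G : SimpleGraph V} {S : Set V} {r : ℕ}
    {a b : V} (h : LinkedIn G S r a b) (ha : a ∈ S) (hb : b ∈ S) :
    ∃ p : ((⊤ : G.Subgraph).induce S).coe.Walk ⟨a, ha⟩ ⟨b, hb⟩, p.length ≤ r := by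
  obtain ⟨p, hp, hS⟩ := h
  have hlen : (p.induce S hS).length = p.length := by
    have := congrArg SimpleGraph.Walk.length (p.map_induce hS)
    rwa [SimpleGraph.Walk.length_map] at this
  have hG := SimpleGraph.induce_eq_coe_induce_top (G := G) S
  rw [← hG]
  exact ⟨p.induce S hS, hlen.le.trans hp⟩

/-- Every set of clusters after `i` rounds models a minor of depth `4 ^ i`, and a graph of edge
density `d` has a vertex of degree at most `2 * d`. -/
theorem isSparse_ofGraph {V : Type*} [Fintype V] (e : V ↪ ℕ) (G : SimpleGraph V) (D : Set V)
    {d : ℕ → ℝ} (hd : ∀ i, nabla (4 ^ i) G ≤ d i) :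
    (ofGraph e G D).IsSparse (Finset.univ.map e) d := by
  classical
  intro i F hF hne
  set I := ofGraph e G D
  have hpos : 0 < F.card := hne.card_pos
  let φ : Fin F.card ≃ F := F.equivFin.symm
  let H : SimpleGraph (Fin F.card) :=
    { Adj := fun a b => I.wt i (φ a) (φ b) ≠ 0
      symm := ⟨fun a b h => by rwa [I.wt_comm]⟩
      loopless := ⟨fun a h => h (I.wt_self i _)⟩ }
  have hminor : IsDepthMinor (4 ^ i) H G := by
    refine ⟨fun a => (⊤ : G.Subgraph).induce {v | I.leader i (e v) = φ a}, ?_, ?_, ?_⟩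
    · intro a
      obtain ⟨u, hu, hua⟩ := Finset.mem_image.1 (hF (φ a).2)
      obtain ⟨v, -, rfl⟩ := Finset.mem_map.1 hu
      have hv := I.linkedIn_leader i (e v)
      rw [hua] at hv
      obtain ⟨c, hc, -⟩ := hv.symm.of_map
      have hcS : c ∈ {v | I.leader i (e v) = φ a} := by
        change I.leader i (e c) = φ a
        rw [hc]
        exact hv.left_mem
      have key : ∀ w : {v | I.leader i (e v) = φ a},
          ∃ p : ((⊤ : G.Subgraph).induce {v | I.leader i (e v) = φ a}).coe.Walk ⟨c, hcS⟩ w,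
            p.length ≤ 4 ^ i := by
        rintro ⟨w, hw⟩
        have hlw := I.linkedIn_leader i (e w)
        have hw' : I.leader i (e w) = φ a := hw
        rw [hw', ← hc] at hlw
        obtain ⟨w', hww', hl⟩ := hlw.of_map
        obtain rfl := e.injective hww'
        rw [hc] at hl
        exact hl.exists_walk_coe_induce hcS hw
      constructor
      · rw [SimpleGraph.connected_iff_exists_forall_reachable]
        exact ⟨⟨c, hcS⟩, fun w => ⟨(key w).choose⟩⟩
      · refine SimpleGraph.radius_le_eccent.trans
          ((SimpleGraph.eccent_le_iff (⟨c, hcS⟩ : {v | I.leader i (e v) = φ a}) _).2 fun w => ?_)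
        obtain ⟨p, hp⟩ := key w
        exact (SimpleGraph.Walk.edist_le p).trans (by exact_mod_cast hp)
    · intro a b hab
      rw [Set.disjoint_left]
      intro v (h1 : I.leader i (e v) = φ a) (h2 : I.leader i (e v) = φ b)
      exact hab (φ.injective (Subtype.ext (h1.symm.trans h2)))
    · intro a b hab
      obtain ⟨-, u, w, hu, hw, huw⟩ := I.exists_adj_of_wt_ne_zero hab
      obtain ⟨u', w', huw', rfl, rfl⟩ := (SimpleGraph.map_adj _ _ _ _).1 huw
      exact ⟨u', hu, w', hw, huw'⟩
  have hdens : (H.edgeSet.ncard : ℝ) / F.card ≤ d i :=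
    (le_csSup (shallowDensities_bddAbove (4 ^ i) G) ⟨_, H, hminor, rfl⟩).trans (hd i)
  rw [div_le_iff₀ (by exact_mod_cast hpos)] at hdens
  have hsum : ∑ a, (H.degree a : ℝ) ≤ ∑ a : Fin F.card, 2 * d i := by
    have h2 := H.sum_degrees_eq_twice_card_edges
    have hE : H.edgeFinset.card = H.edgeSet.ncard := by
      rw [← SimpleGraph.coe_edgeFinset, Set.ncard_coe_finset]
    rw [hE] at h2
    have h3 : ∑ a, (H.degree a : ℝ) = 2 * H.edgeSet.ncard := by exact_mod_cast h2
    rw [h3, Finset.sum_const, Finset.card_univ, Fintype.card_fin, nsmul_eq_mul]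
    linarith
  obtain ⟨a, -, ha⟩ := Finset.exists_le_of_sum_le ⟨⟨0, hpos⟩, Finset.mem_univ _⟩ hsum
  refine ⟨φ a, (φ a).2, le_trans ?_ ha⟩
  rw [Nat.cast_le, SimpleGraph.degree]
  refine (Finset.card_le_card (t := (H.neighborFinset a).map
    (φ.toEmbedding.trans (Function.Embedding.subtype _))) fun y hy => ?_).trans_eq
    (Finset.card_map _)
  obtain ⟨hy, hwt⟩ := Finset.mem_filter.1 hy
  refine Finset.mem_map.2 ⟨φ.symm ⟨y, hy⟩, ?_, by simp⟩
  rw [SimpleGraph.mem_neighborFinset]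
  change I.wt i (φ a) (φ (φ.symm ⟨y, hy⟩)) ≠ 0
  simpa using hwt

end Network

/-- Sub-logarithmic expansion makes the density grow slower than the number of rounds, so that the
weight between clusters tends to zero. -/
theorem tendsto_prod_one_sub_of_isLittleO {f : ℕ → ℕ}
    (hf : (fun r : ℕ => (f r : ℝ)) =o[atTop] (fun r : ℕ => Real.log (r : ℝ))) :
    Tendsto (fun N => ∏ j ∈ Finset.range N, (1 - 1 / (16 * max 1 (f (4 ^ j) : ℝ)))) atTop
      (nhds 0) := by
  have hlog4 : Real.log 4 ≤ 4 := (Real.log_le_sub_one_of_pos (by norm_num)).trans (by norm_num)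
  -- eventually `f (4 ^ j) ≤ log (4 ^ j) / 4 ≤ j`
  obtain ⟨j₀, hj₀⟩ : ∃ j₀ : ℕ, ∀ j ≥ j₀, (f (4 ^ j) : ℝ) ≤ j := by
    have h1 := hf.def (c := 1 / 4) (by norm_num)
    have h2 : Tendsto (fun j : ℕ => 4 ^ j) atTop (atTop : Filter ℕ) :=
      tendsto_pow_atTop_atTop_of_one_lt (by norm_num)
    obtain ⟨j₀, hj₀⟩ := eventually_atTop.1 (h2.eventually h1)
    refine ⟨j₀, fun j hj => ?_⟩
    have h3 := hj₀ j hj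
    push_cast at h3
    rw [Real.log_pow, Real.norm_of_nonneg (by positivity),
      Real.norm_of_nonneg (mul_nonneg (by positivity) (Real.log_nonneg (by norm_num)))] at h3
    nlinarith [(Nat.cast_nonneg j : (0 : ℝ) ≤ j)]
  have hterm : ∀ j, (0 : ℝ) ≤ 1 - 1 / (16 * max 1 (f (4 ^ j) : ℝ)) := by
    intro j
    have : (1 : ℝ) ≤ max 1 (f (4 ^ j) : ℝ) := le_max_left _ _
    rw [sub_nonneg, div_le_one (by positivity)]
    linarith
  have hsum : Tendsto (fun N => ∑ j ∈ Finset.range N, 1 / (16 * max 1 (f (4 ^ j) : ℝ))) atTop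
      atTop := by
    have hharm := Real.tendsto_sum_range_one_div_nat_succ_atTop
    rw [← not_summable_iff_tendsto_nat_atTop_of_nonneg (fun j => by positivity)] at hharm ⊢
    intro hs
    refine hharm ?_
    rw [← summable_nat_add_iff j₀] at hs ⊢
    refine Summable.of_nonneg_of_le (fun j => by positivity) (fun j => ?_) (hs.mul_left 16)
    have h1 := hj₀ (j + j₀) (by omega)
    have h2 : max 1 (f (4 ^ (j + j₀)) : ℝ) ≤ ((j + j₀ : ℕ) : ℝ) + 1 :=
      max_le (by linarith [(Nat.cast_nonneg (j + j₀) : (0 : ℝ) ≤ ((j + j₀ : ℕ) : ℝ))])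
        (by linarith)
    have h3 : (0 : ℝ) < max 1 (f (4 ^ (j + j₀)) : ℝ) := lt_of_lt_of_le one_pos (le_max_left _ _)
    rw [show (16 : ℝ) * (1 / (16 * max 1 (f (4 ^ (j + j₀)) : ℝ))) =
      1 / max 1 (f (4 ^ (j + j₀)) : ℝ) by field_simp]
    exact one_div_le_one_div_of_le h3 h2
  refine squeeze_zero (fun N => Finset.prod_nonneg fun j _ => hterm j) (fun N => ?_)
    (Real.tendsto_exp_neg_atTop_nhds_zero.comp hsum)
  rw [Function.comp_apply, ← Finset.sum_neg_distrib, Real.exp_sum]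
  refine Finset.prod_le_prod (fun j _ => hterm j) fun j _ => ?_
  linarith [Real.add_one_le_exp (-(1 / (16 * max 1 (f (4 ^ j) : ℝ))))]

/-! ### Histories and what determines them -/

/-- The knowledge that an agent publishes about itself: its identifier, the identifiers of its
neighbours, and whether it is marked. -/
abbrev Record := ℕ × Set ℕ × Prop

namespace Network

/-- The network `J` is consistent with the records `R`. -/
def Models (J : Network) (R : Set Record) : Prop :=
  ∀ r ∈ R, J.graph.neighborSet r.1 = r.2.1 ∧ (r.1 ∈ J.marked ↔ r.2.2)

/-- The parent, the colour and the side of the cluster `x` after `i` rounds of merging and `k` steps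
of the next round. -/
noncomputable def clusterState (I : Network) (i k x : ℕ) : ℕ × ℕ × ℝ :=
  (I.par i x, colorAt (I.par i) k x, sideAt (I.wt i) (I.par i) k x)

open Classical in
/-- Everything about the clusters of `v` in the first `N` rounds of merging that `v` or another
member of these clusters ever needs: in each round the leader, the view, and the states of the
cluster of `v` and of its neighbouring clusters at all steps. -/
noncomputable def history (N : ℕ) (I : Network) (v : ℕ) :
    (Set ℕ × Prop) × (Fin (N + 1) → ℕ × ClusterView × (ℕ → ℕ → ℕ × ℕ × ℝ)) :=
  ((I.graph.neighborSet v, v ∈ I.marked), fun i =>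
    (I.leader i v, I.view i (I.leader i v), fun k y =>
      if y = I.leader i v ∨ I.wt i (I.leader i v) y ≠ 0 then I.clusterState i k y else (0, 0, 0)))

/-- The records `R` determine the history of `v`. -/
def Settled (N : ℕ) (R : Set Record) (v : ℕ) : Prop :=
  ∃ h, ∀ J : Network, J.Models R → history N J v = h

variable {I J : Network} {N i k v x y : ℕ}

theorem wt_congr (h : J.view i x = I.view i x) (y : ℕ) : J.wt i x y = I.wt i x y := by
  rw [wt, wt, h]

theorem par_congr (h : J.view i x = I.view i x) : J.par i x = I.par i x := by
  rw [par, par, h]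

theorem clusterState_zero_congr (h : J.view i x = I.view i x) :
    J.clusterState i 0 x = I.clusterState i 0 x := by
  rw [clusterState, clusterState, par_congr h]
  rfl

/-- The state of a cluster at the next step is determined by its view and by the present states of
the cluster and its neighbours. -/
theorem clusterState_succ_congr (h : J.view i x = I.view i x)
    (hx : J.clusterState i k x = I.clusterState i k x)
    (hy : ∀ y, I.wt i x y ≠ 0 → J.clusterState i k y = I.clusterState i k y) :
    J.clusterState i (k + 1) x = I.clusterState i (k + 1) x := by
  have hp := par_congr h
  simp only [clusterState, Prod.mk.injEq] at hx hy ⊢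
  have hpar : colorAt (J.par i) k (I.par i x) = colorAt (I.par i) k (I.par i x) ∧
      sideAt (J.wt i) (J.par i) k (I.par i x) = sideAt (I.wt i) (I.par i) k (I.par i x) := by
    rcases I.par_eq_or i x with h1 | h1
    · rw [h1]
      exact hx.2
    · exact (hy _ h1.1).2
  refine ⟨hp, ?_, ?_⟩
  · simp only [colorAt, referenceColor, hp, hx.2.1, hpar.1]
  · have hsum : ∀ y, (if J.par i y = x then
        (J.wt i x y : ℝ) * (1 - sideAt (J.wt i) (J.par i) k y) else 0) =
        if I.par i y = x then (I.wt i x y : ℝ) * (1 - sideAt (I.wt i) (I.par i) k y) else 0 := by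
      intro y
      rw [wt_congr h]
      by_cases hw : I.wt i x y = 0
      · simp [hw]
      · rw [(hy y hw).1, (hy y hw).2.2]
    rw [sideAt, sideAt, hp, hx.2.1, hx.2.2, hpar.2, wt_congr h, finsum_congr hsum]

/-- The state of a cluster does not change after a number of steps that depends on its level. -/
theorem clusterState_congr_of_le
    (h : ∀ k ≤ 8 * level x + 8, J.clusterState i k x = I.clusterState i k x) (k : ℕ) :
    J.clusterState i k x = I.clusterState i k x := by
  by_cases hk : k ≤ 8 * level x + 8
  · exact h k hk
  have h1 := h (level x) (by omega)
  have h2 := h (8 * level x + 8) le_rfl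
  simp only [clusterState, Prod.mk.injEq] at h1 h2 ⊢
  refine ⟨h2.1, ?_, ?_⟩
  · rw [colorAt_of_level_le _ (show level x ≤ k by omega),
      colorAt_of_level_le _ (show level x ≤ k by omega), h1.2.1]
  · rw [sideAt_eq_side _ _ (show 8 * level x + 8 ≤ k by omega),
      sideAt_eq_side _ _ (show 8 * level x + 8 ≤ k by omega)]
    exact h2.2.2

theorem leader_succ_congr (hl : J.leader i v = I.leader i v)
    (hs : ∀ k y, y = I.leader i v ∨ I.wt i (I.leader i v) y ≠ 0 →
      J.clusterState i k y = I.clusterState i k y) :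
    J.leader (i + 1) v = I.leader (i + 1) v := by
  simp only [clusterState, Prod.mk.injEq] at hs
  rw [leader_succ, leader_succ, hl]
  have hx := hs 0 _ (Or.inl rfl)
  have hpar : I.par i (I.leader i v) = I.leader i v ∨
      I.wt i (I.leader i v) (I.par i (I.leader i v)) ≠ 0 :=
    (I.par_eq_or i _).imp id fun h => h.1
  unfold move side
  rw [hx.1, (hs _ _ (Or.inl rfl)).2.2, (hs _ _ hpar).2.2]

theorem star_congr (h : ∀ w, w = v ∨ I.graph.Adj v w →
    J.graph.neighborSet w = I.graph.neighborSet w ∧ (w ∈ J.marked ↔ w ∈ I.marked)) :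
    J.star v = I.star v := by
  have hadj : ∀ w, J.graph.Adj v w ↔ I.graph.Adj v w := fun w => by
    rw [← SimpleGraph.mem_neighborSet, (h v (Or.inl rfl)).1, SimpleGraph.mem_neighborSet]
  have hd : ∀ d, (d ∈ J.marked ∧ J.graph.Adj v d) ↔ (d ∈ I.marked ∧ I.graph.Adj v d) := by
    intro d
    rw [hadj]
    constructor
    · exact fun h' => ⟨(h d (Or.inr h'.2)).2.1 h'.1, h'.2⟩
    · exact fun h' => ⟨(h d (Or.inr h'.2)).2.2 h'.1, h'.2⟩
  have hc : (v ∉ J.marked ∧ ∃ d, d ∈ J.marked ∧ J.graph.Adj v d) ↔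
      (v ∉ I.marked ∧ ∃ d, d ∈ I.marked ∧ I.graph.Adj v d) :=
    and_congr (not_congr (h v (Or.inl rfl)).2) (exists_congr hd)
  have hset : {d | d ∈ J.marked ∧ J.graph.Adj v d} = {d | d ∈ I.marked ∧ I.graph.Adj v d} :=
    Set.ext hd
  unfold star
  by_cases hv : v ∉ I.marked ∧ ∃ d, d ∈ I.marked ∧ I.graph.Adj v d
  · rw [if_pos hv, if_pos (hc.2 hv), hset]
  · rw [if_neg hv, if_neg (mt hc.1 hv)]

theorem history_congr_iff : history N J v = history N I v ↔
    (J.graph.neighborSet v = I.graph.neighborSet v ∧ (v ∈ J.marked ↔ v ∈ I.marked)) ∧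
    ∀ i ≤ N, J.leader i v = I.leader i v ∧
      J.view i (I.leader i v) = I.view i (I.leader i v) ∧
      ∀ k y, y = I.leader i v ∨ I.wt i (I.leader i v) y ≠ 0 →
        J.clusterState i k y = I.clusterState i k y := by
  constructor
  · intro h
    simp only [history, Prod.mk.injEq, eq_iff_iff] at h
    refine ⟨h.1, fun i hi => ?_⟩
    have h1 := congrFun h.2 ⟨i, Nat.lt_succ_of_le hi⟩
    simp only [Prod.mk.injEq] at h1
    obtain ⟨h2, h3, h4⟩ := h1
    rw [h2] at h3
    refine ⟨h2, h3, fun k y hy => ?_⟩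
    have h5 := congrFun (congrFun h4 k) y
    rw [h2, wt_congr h3, if_pos hy, if_pos hy] at h5
    exact h5
  · rintro ⟨h1, h2⟩
    simp only [history, Prod.mk.injEq, eq_iff_iff]
    refine ⟨h1, funext fun i => ?_⟩
    obtain ⟨h3, h4, h5⟩ := h2 i (Nat.le_of_lt_succ i.2)
    simp only [Prod.mk.injEq]
    rw [h3]
    refine ⟨rfl, h4, funext fun k => funext fun y => ?_⟩
    rw [wt_congr h4]
    split_ifs with hy
    · exact h5 k y hy
    · rfl

/-- If the neighbourhoods, stars and leaders in the closed neighbourhoods of all members of a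
cluster are the same in `J` as in `I`, then so is the view of the cluster: as clusters of `J` are
connected, the cluster cannot have further members in `J`. -/
theorem view_congr (h : ∀ u, I.leader i u = I.leader i v →
    J.graph.neighborSet u = I.graph.neighborSet u ∧ ∀ w, w = u ∨ I.graph.Adj u w →
      J.star w = I.star w ∧ J.leader i w = I.leader i w) :
    J.view i (I.leader i v) = I.view i (I.leader i v) := by
  set x := I.leader i v
  have hmem : ∀ u, J.leader i u = x ↔ I.leader i u = x := by
    intro u
    constructor
    · intro hu
      have hlink := J.linkedIn_leader i u
      rw [hu] at hlink
      refine LinkedIn.induction (P := fun _ w => I.leader i w = x) hlink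
        (I.leader_leader i v) ?_ (fun _ _ h => h)
      intro _ w w' hw _ hw' hadj
      have hadj' : I.graph.Adj w w' := by
        rwa [← SimpleGraph.mem_neighborSet, ← (h w hw).1, SimpleGraph.mem_neighborSet]
      rw [← ((h w hw).2 w' (Or.inr hadj')).2]
      exact hw'
    · intro hu
      rw [((h u hu).2 u (Or.inl rfl)).2, hu]
  ext ⟨u, w, a, b, y⟩
  rw [mem_view, mem_view, hmem]
  refine and_congr_right fun hu => ?_
  have hadj : J.graph.Adj u w ↔ I.graph.Adj u w := by
    rw [← SimpleGraph.mem_neighborSet, (h u hu).1, SimpleGraph.mem_neighborSet]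
  rw [hadj]
  refine and_congr_right fun huw => ?_
  obtain ⟨h1, h2⟩ := (h u hu).2 w (huw.imp Eq.symm id)
  rw [((h u hu).2 u (Or.inl rfl)).1, h1, h2]

/-! ### The spread of knowledge -/

/-- The records `known t v` that the agents `v ∈ U` have collected after `t` rounds of exchanging
all their records, when an agent stops as soon as its records determine its history. -/
structure IsGossip (I : Network) (N : ℕ) (U : Finset ℕ) (known : ℕ → ℕ → Set Record) : Prop where
  adj_mem : ∀ u w, I.graph.Adj u w → u ∈ U
  models : ∀ t, ∀ v ∈ U, I.Models (known t v)
  step : ∀ t, ∀ v ∈ U, (Settled N (known t v) v ∧ known (t + 1) v = known t v) ∨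
    ((v, I.graph.neighborSet v, v ∈ I.marked) ∈ known (t + 1) v ∧
      ∀ w, w = v ∨ I.graph.Adj v w → known t w ⊆ known (t + 1) v)

/-- The records `R` imply the property `P` of the network. -/
def Entails (R : Set Record) (P : Network → Prop) : Prop := ∀ J : Network, J.Models R → P J

namespace IsGossip

variable {U : Finset ℕ} {known : ℕ → ℕ → Set Record} (hg : IsGossip I N U known)
include hg

theorem history_eq_of_settled {t : ℕ} (hv : v ∈ U) (hs : Settled N (known t v) v)
    (hJ : J.Models (known t v)) : history N J v = history N I v := by
  obtain ⟨h, hh⟩ := hs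
  rw [hh J hJ, hh I (hg.models t v hv)]

theorem mono {t s : ℕ} (hv : v ∈ U) {P : Network → Prop} (h : Entails (known t v) P)
    (hts : t ≤ s) : Entails (known s v) P := by
  induction s, hts using Nat.le_induction with
  | base => exact h
  | succ s _ ih =>
    intro J hJ
    refine ih J fun r hr => hJ r ?_
    rcases hg.step s v hv with ⟨-, h1⟩ | ⟨-, h1⟩
    · rwa [h1]
    · exact h1 v (Or.inl rfl) hr

/-- An agent learns what its neighbours know, or else it has stopped, and then it knows everything
about its own history. -/
theorem entails_succ {t : ℕ} (hv : v ∈ U) {P : Network → Prop} {Q : ℕ → Network → Prop}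
    (hH : ∀ J, history N J v = history N I v → P J)
    (hL : ∀ J, (∀ w, w = v ∨ I.graph.Adj v w → Q w J) → P J)
    (hQ : ∀ w, w = v ∨ I.graph.Adj v w → Entails (known t w) (Q w)) :
    Entails (known (t + 1) v) P := by
  intro J hJ
  rcases hg.step t v hv with ⟨hs, h1⟩ | ⟨-, h1⟩
  · rw [h1] at hJ
    exact hH J (hg.history_eq_of_settled hv hs hJ)
  · exact hL J fun w hw => hQ w hw J fun r hr => hJ r (h1 w hw hr)

theorem entails_record (t : ℕ) (hv : v ∈ U) : Entails (known (t + 1) v) fun J =>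
    J.graph.neighborSet v = I.graph.neighborSet v ∧ (v ∈ J.marked ↔ v ∈ I.marked) := by
  intro J hJ
  rcases hg.step t v hv with ⟨hs, h1⟩ | ⟨h1, -⟩
  · rw [h1] at hJ
    exact (history_congr_iff.1 (hg.history_eq_of_settled hv hs hJ)).1
  · exact hJ _ h1

theorem entails_star (hv : v ∈ U) : Entails (known 2 v) fun J => J.star v = I.star v := by
  refine hg.entails_succ hv (fun J h => ?_) (fun J h => star_congr h) fun w hw =>
    hg.entails_record 0 ?_
  · exact ((history_congr_iff.1 h).2 0 (Nat.zero_le _)).1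
  · rcases hw with rfl | hw
    · exact hv
    · exact hg.adj_mem _ _ hw.symm

/-- Facts that are part of the history of every member of a cluster spread through the cluster. -/
theorem entails_of_linkedIn {t r u : ℕ} (hu : u ∈ U) {S : Set ℕ} (hl : LinkedIn I.graph S r u v)
    {P : Network → Prop} (hH : ∀ w ∈ S, w ∈ U → ∀ J, history N J w = history N I w → P J)
    (h : Entails (known t u) P) : v ∈ U ∧ Entails (known (t + r) v) P := by
  refine LinkedIn.induction (P := fun k w => w ∈ U ∧ Entails (known (t + k) w) P) hl ⟨hu, h⟩
    ?_ ?_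
  · rintro k a b ⟨ha, hk⟩ _ hbS hab
    have hb := hg.adj_mem _ _ hab.symm
    refine ⟨hb, hg.entails_succ (t := t + k) (Q := fun w J => w = a → P J) hb (hH b hbS hb)
      (fun J hJ => hJ a (Or.inr hab.symm) rfl) ?_⟩
    rintro w - J hJ rfl
    exact hk J hJ
  · rintro k a ⟨ha, hk⟩
    exact ⟨ha, hg.mono ha hk (by omega)⟩

theorem mem_of_leader_eq {u : ℕ} (hv : v ∈ U) (h : I.leader i u = I.leader i v) : u ∈ U :=
  mem_of_leader_mem_leaders hg.adj_mem (i := i) (by rw [h]; exact Finset.mem_image_of_mem _ hv)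

theorem leader_mem (hv : v ∈ U) : I.leader i v ∈ U := hg.mem_of_leader_eq hv (I.leader_leader i v)

theorem entails_view {t : ℕ} (hi : i ≤ N)
    (h : ∀ v ∈ U, Entails (known t v) fun J => J.graph.neighborSet v = I.graph.neighborSet v ∧
      J.star v = I.star v ∧ J.leader i v = I.leader i v) (hv : v ∈ U) :
    Entails (known (t + 1 + 2 * 4 ^ i) v) fun J =>
      J.view i (I.leader i v) = I.view i (I.leader i v) := by
  set P : ℕ → Network → Prop := fun u J => J.graph.neighborSet u = I.graph.neighborSet u ∧
    ∀ w, w = u ∨ I.graph.Adj u w → J.star w = I.star w ∧ J.leader i w = I.leader i w with hP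
  have hist : ∀ u w, I.leader i w = I.leader i u → ∀ J, history N J w = history N I w → P u J := by
    intro u w hwu J hJ
    have hview := ((history_congr_iff.1 hJ).2 i hi).2.1
    rw [hwu] at hview
    have hmem : ∀ z, (u = z ∨ I.graph.Adj u z) →
        (u, z, I.star u, I.star z, I.leader i z) ∈ J.view i (I.leader i u) := by
      intro z hz
      rw [hview]
      exact ⟨rfl, hz, rfl, rfl, rfl⟩
    refine ⟨?_, fun z hz => ?_⟩
    · ext z
      rw [SimpleGraph.mem_neighborSet, SimpleGraph.mem_neighborSet]
      constructor
      · intro hz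
        have h1 : (u, z, J.star u, J.star z, J.leader i z) ∈ J.view i (I.leader i u) :=
          ⟨(hmem u (Or.inl rfl)).1, Or.inr hz, rfl, rfl, rfl⟩
        rw [hview] at h1
        exact h1.2.1.resolve_left hz.ne
      · intro hz
        exact (hmem z (Or.inr hz)).2.1.resolve_left hz.ne
    · obtain ⟨-, -, -, h1, h2⟩ := hmem z (hz.imp Eq.symm id)
      exact ⟨h1.symm, h2.symm⟩
  have hloc : ∀ u ∈ U, Entails (known (t + 1) u) (P u) := fun u hu =>
    hg.entails_succ hu (hist u u rfl)
      (fun J hJ => ⟨(hJ u (Or.inl rfl)).1, fun w hw => (hJ w hw).2⟩)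
      fun w hw => h w (hw.elim (fun e => e ▸ hu) fun e => hg.adj_mem _ _ e.symm)
  intro J hJ
  refine view_congr fun u hu => ?_
  exact (hg.entails_of_linkedIn (hg.mem_of_leader_eq hv hu) (I.linkedIn_cluster hu)
    (fun w hw _ => hist u w (hw.trans hu.symm)) (hloc u (hg.mem_of_leader_eq hv hu))).2 J hJ

/-- What is known in every cluster about its own state is soon known in the neighbouring
clusters. -/
theorem entails_neighbor {t : ℕ} (hi : i ≤ N)
    (h : ∀ v ∈ U, Entails (known t v) fun J =>
      J.clusterState i k (I.leader i v) = I.clusterState i k (I.leader i v)) (hv : v ∈ U) :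
    Entails (known (t + (1 + 2 * 4 ^ i)) v) fun J =>
      ∀ y, y = I.leader i v ∨ I.wt i (I.leader i v) y ≠ 0 →
        J.clusterState i k y = I.clusterState i k y := by
  rintro J hJ y (rfl | hy)
  · exact hg.mono hv (h v hv) (by omega) J hJ
  obtain ⟨-, u, w, hu, rfl, huw⟩ := I.exists_adj_of_wt_ne_zero hy
  set P : Network → Prop := fun J =>
    J.clusterState i k (I.leader i w) = I.clusterState i k (I.leader i w)
  have hist : ∀ z, I.leader i z = I.leader i v → ∀ J, history N J z = history N I z → P J := by
    intro z hz J hJ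
    exact ((history_congr_iff.1 hJ).2 i hi).2.2 k _ (Or.inr (by rwa [hz]))
  have hw := hg.adj_mem _ _ huw.symm
  have huU := hg.adj_mem _ _ huw
  have h1 : Entails (known (t + 1) u) P := by
    refine hg.entails_succ (Q := fun z J => z = w → P J) huU (hist u hu)
      (fun J hJ => hJ w (Or.inr huw) rfl) ?_
    rintro z - J hJ rfl
    exact h _ hw J hJ
  have h2 := (hg.entails_of_linkedIn huU (I.linkedIn_cluster hu) (fun z hz _ => hist z hz) h1).2
  rw [add_assoc] at h2
  exact h2 J hJ

theorem entails_clusterState {t : ℕ} (hi : i ≤ N)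
    (h : ∀ v ∈ U, Entails (known t v) fun J => J.graph.neighborSet v = I.graph.neighborSet v ∧
      J.star v = I.star v ∧ J.leader i v = I.leader i v) (k : ℕ) : ∀ v ∈ U,
    Entails (known (t + (k + 1) * (1 + 2 * 4 ^ i)) v) fun J =>
      J.clusterState i k (I.leader i v) = I.clusterState i k (I.leader i v) := by
  have hview : ∀ k, ∀ v ∈ U, Entails (known (t + (k + 1) * (1 + 2 * 4 ^ i)) v) fun J =>
      J.view i (I.leader i v) = I.view i (I.leader i v) := fun k v hv =>
    hg.mono hv (hg.entails_view hi h hv) (by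
      have := Nat.le_mul_of_pos_left (1 + 2 * 4 ^ i) (show 0 < k + 1 by omega)
      omega)
  induction k with
  | zero => exact fun v hv J hJ => clusterState_zero_congr (hview 0 v hv J hJ)
  | succ k ih =>
    intro v hv J hJ
    have h1 := hg.mono (s := t + (k + 1 + 1) * (1 + 2 * 4 ^ i)) hv
      (hg.entails_neighbor hi ih hv) (by rw [add_mul (k + 1), one_mul, add_assoc])
    exact clusterState_succ_congr (hview (k + 1) v hv J hJ) (h1 J hJ _ (Or.inl rfl))
      fun y hy => h1 J hJ y (Or.inr hy)

/-- One round of merging: once every agent knows its leader, it takes a number of rounds that is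
linear in the maximal level of an identifier until every agent knows its cluster and all states of
this cluster and its neighbours. -/
theorem entails_round {t L : ℕ} (hi : i ≤ N) (hL : ∀ v ∈ U, level v ≤ L)
    (h : ∀ v ∈ U, Entails (known t v) fun J => J.graph.neighborSet v = I.graph.neighborSet v ∧
      J.star v = I.star v ∧ J.leader i v = I.leader i v) (hv : v ∈ U) :
    Entails (known (t + (8 * L + 10) * (1 + 2 * 4 ^ i)) v) fun J =>
      J.leader i v = I.leader i v ∧ J.view i (I.leader i v) = I.view i (I.leader i v) ∧
      ∀ k y, y = I.leader i v ∨ I.wt i (I.leader i v) y ≠ 0 →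
        J.clusterState i k y = I.clusterState i k y := by
  intro J hJ
  have hle := Nat.le_mul_of_pos_left (1 + 2 * 4 ^ i) (show 0 < 8 * L + 10 by omega)
  refine ⟨(hg.mono hv (h v hv) (by omega) J hJ).2.2,
    hg.mono hv (hg.entails_view hi h hv) (by omega) J hJ, fun k y hy => ?_⟩
  have hyU : y ∈ U := by
    rcases hy with rfl | hy
    · exact hg.leader_mem hv
    · obtain ⟨-, u, w, -, rfl, huw⟩ := I.exists_adj_of_wt_ne_zero hy
      exact hg.leader_mem (hg.adj_mem _ _ huw.symm)
  refine clusterState_congr_of_le (fun k hk => ?_) k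
  have hkL : k ≤ 8 * L + 8 := hk.trans (by have := hL y hyU; omega)
  refine hg.mono hv (hg.entails_neighbor hi (hg.entails_clusterState hi h k) hv) ?_ J hJ y hy
  have : (k + 2) * (1 + 2 * 4 ^ i) ≤ (8 * L + 10) * (1 + 2 * 4 ^ i) :=
    Nat.mul_le_mul_right _ (by omega)
  linarith

theorem entails_leader {L : ℕ} (hL : ∀ v ∈ U, level v ≤ L) (i : ℕ) : i ≤ N + 1 → ∀ v ∈ U,
    Entails (known (2 + ∑ j ∈ Finset.range i, (8 * L + 10) * (1 + 2 * 4 ^ j)) v) fun J =>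
      J.graph.neighborSet v = I.graph.neighborSet v ∧
      J.star v = I.star v ∧ J.leader i v = I.leader i v := by
  induction i with
  | zero =>
    intro _ v hv J hJ
    rw [Finset.range_zero, Finset.sum_empty] at hJ
    have h1 := hg.entails_star hv J hJ
    exact ⟨(hg.entails_record 1 hv J hJ).1, h1, h1⟩
  | succ i ih =>
    intro hi v hv J hJ
    have ih' := ih (by omega)
    have h1 := hg.entails_round (by omega) hL ih' hv
    rw [Finset.sum_range_succ, ← add_assoc] at hJ
    have h2 := hg.mono hv (ih' v hv) (by omega) J hJ
    obtain ⟨h3, -, h4⟩ := h1 J hJ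
    exact ⟨h2.1, h2.2.1, leader_succ_congr h3 h4⟩

/-- All agents have stopped after a number of rounds that is linear in the maximal level of an
identifier. -/
theorem settled {L : ℕ} (hL : ∀ v ∈ U, level v ≤ L) (hv : v ∈ U) :
    Settled N (known (2 + ∑ j ∈ Finset.range (N + 1), (8 * L + 10) * (1 + 2 * 4 ^ j)) v) v := by
  refine ⟨history N I v, fun J hJ => history_congr_iff.2 ⟨?_, fun i hi => ?_⟩⟩
  · exact hg.mono hv (hg.entails_record 0 hv) (by omega) J hJ
  · refine hg.mono hv (hg.entails_round hi hL (hg.entails_leader hL i (by omega)) hv) ?_ J hJ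
    rw [add_assoc, ← Finset.sum_range_succ]
    exact Nat.add_le_add_left (Finset.sum_le_sum_of_subset
      (Finset.range_subset_range.2 (by omega))) _

end IsGossip

end Network

/-! ### The distributed algorithm -/

/-- The state of an agent: its identifier, its local input and the records that it has collected. -/
structure AgentState where
  ident : ℕ
  input : NodeInput
  known : Set Record

open Classical in
/-- The agents exchange all their records. An agent stops as soon as all networks that are
consistent with its records give it the same history in the first `rounds` rounds of merging,
where `rounds` depends on the local input. It answers yes if it is selected by the optimal solution
of its cluster. -/
noncomputable def gossipAlgorithm (rounds : NodeInput → ℕ) : LocalAlgorithm NodeInput Bool where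
  State := AgentState
  Msg := ℕ × Set Record
  init id inp := ⟨id, inp, ∅⟩
  send s _ := (s.ident, s.known)
  receive s msgs := ⟨s.ident, s.input,
    {(s.ident, {j | ∃ m ∈ msgs, m.1 = j}, s.input.inD = true)} ∪ s.known ∪
      {r | ∃ m ∈ msgs, r ∈ m.2}⟩
  output s :=
    if Network.Settled (rounds s.input) s.known s.ident then
      some (decide (∃ J : Network, J.Models s.known ∧ s.ident ∈ Network.clusterSolution
        (J.view (rounds s.input) (J.leader (rounds s.input) s.ident))))
    else none

namespace gossipAlgorithm

open Network

variable {V : Type*} [DecidableEq V] {G : SimpleGraph V} (P : PortNumbering G) (e : V ↪ ℕ)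
  (inp : V → NodeInput) (rounds : NodeInput → ℕ)

theorem run_succ (t : ℕ) : (gossipAlgorithm rounds).run P e inp (t + 1) =
    (gossipAlgorithm rounds).round P ((gossipAlgorithm rounds).run P e inp t) :=
  Function.iterate_succ_apply' _ _ _

/-- In a round an agent either has stopped or adds its own record and those of its neighbours. -/
theorem round_eq (s : V → AgentState) (v : V) :
    (Settled (rounds (s v).input) (s v).known (s v).ident ∧
      (gossipAlgorithm rounds).round P s v = s v) ∨
    (gossipAlgorithm rounds).round P s v = ⟨(s v).ident, (s v).input,
      {((s v).ident, {j | ∃ w, G.Adj v w ∧ (s w).ident = j}, (s v).input.inD = true)} ∪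
        (s v).known ∪ {r | ∃ w, G.Adj v w ∧ r ∈ (s w).known}⟩ := by
  by_cases h : Settled (rounds (s v).input) (s v).known (s v).ident
  · left
    refine ⟨h, ?_⟩
    simp only [LocalAlgorithm.round, gossipAlgorithm, if_pos h]
  · right
    simp only [LocalAlgorithm.round, gossipAlgorithm, if_neg h]
    congr 1
    simp [P.mem_nbrs]

theorem run_ident_input (t : ℕ) (v : V) :
    ((gossipAlgorithm rounds).run P e inp t v : AgentState).ident = e v ∧
      ((gossipAlgorithm rounds).run P e inp t v : AgentState).input = inp v := by
  induction t with
  | zero => exact ⟨rfl, rfl⟩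
  | succ t ih =>
    rw [run_succ]
    rcases round_eq P rounds ((gossipAlgorithm rounds).run P e inp t) v with ⟨-, h⟩ | h
    · rw [h]
      exact ih
    · rw [h]
      exact ih

theorem output_of_settled (s : AgentState) (h : Settled (rounds s.input) s.known s.ident) :
    ((gossipAlgorithm rounds).output s).isSome ∧ ((gossipAlgorithm rounds).output s = some true ↔
      ∃ J : Network, J.Models s.known ∧
        s.ident ∈ clusterSolution
          (J.view (rounds s.input) (J.leader (rounds s.input) s.ident))) := by
  simp [gossipAlgorithm, h]

/-- The records of the agent with identifier `u` after `t` rounds. -/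
def known (t u : ℕ) : Set Record :=
  {r | ∃ v, e v = u ∧ r ∈ ((gossipAlgorithm rounds).run P e inp t v : AgentState).known}

theorem known_apply (t : ℕ) (v : V) : known P e inp rounds t (e v) =
    ((gossipAlgorithm rounds).run P e inp t v : AgentState).known := by
  ext r
  constructor
  · rintro ⟨w, hw, hr⟩
    rwa [← e.injective hw]
  · exact fun hr => ⟨v, rfl, hr⟩

theorem known_succ {D : Set V} {N : ℕ} (hin : ∀ v, (inp v).inD = true ↔ v ∈ D)
    (hN : ∀ v, rounds (inp v) = N) (t : ℕ) (v : V) :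
    (Settled N (known P e inp rounds t (e v)) (e v) ∧
      known P e inp rounds (t + 1) (e v) = known P e inp rounds t (e v)) ∨
    known P e inp rounds (t + 1) (e v) =
      {(e v, (ofGraph e G D).graph.neighborSet (e v), e v ∈ (ofGraph e G D).marked)} ∪
        known P e inp rounds t (e v) ∪ {r | ∃ w, G.Adj v w ∧ r ∈ known P e inp rounds t (e w)} := by
  simp only [known_apply]
  have hid := run_ident_input P e inp rounds t
  rw [run_succ]
  rcases round_eq P rounds ((gossipAlgorithm rounds).run P e inp t) v with ⟨hs, h⟩ | h
  · left
    rw [(hid v).1, (hid v).2, hN] at hs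
    exact ⟨hs, by rw [h]⟩
  · right
    rw [h]
    have h1 : {j | ∃ w, G.Adj v w ∧
        ((gossipAlgorithm rounds).run P e inp t w : AgentState).ident = j} =
        (ofGraph e G D).graph.neighborSet (e v) := by
      ext j
      simp only [(hid _).1, Set.mem_ofPred_eq, SimpleGraph.mem_neighborSet]
      exact (ofGraph_adj).symm
    have h2 : ((inp v).inD = true) = (e v ∈ (ofGraph e G D).marked) := by
      rw [eq_iff_iff, hin]
      exact (e.injective.mem_set_image).symm
    simp only [(hid v).1, (hid v).2, h1, h2]

theorem isGossip [Fintype V] {D : Set V} {N : ℕ} (hin : ∀ v, (inp v).inD = true ↔ v ∈ D)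
    (hN : ∀ v, rounds (inp v) = N) :
    IsGossip (ofGraph e G D) N (Finset.univ.map e) (known P e inp rounds) where
  adj_mem u w h := by
    obtain ⟨a, b, -, rfl, -⟩ := (SimpleGraph.map_adj _ _ _ _).1 h
    simp
  models t := by
    intro u hu
    obtain ⟨v, -, rfl⟩ := Finset.mem_map.1 hu
    clear hu
    induction t generalizing v with
    | zero =>
      rw [known_apply]
      exact fun r hr => hr.elim
    | succ t ih =>
      rcases known_succ P e inp rounds hin hN t v with ⟨-, h⟩ | h
      · rw [h]
        exact ih v
      · rw [h]
        rintro r ((rfl | hr) | ⟨w, -, hr⟩)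
        · exact ⟨rfl, Iff.rfl⟩
        · exact ih v r hr
        · exact ih w r hr
  step t := by
    intro u hu
    obtain ⟨v, -, rfl⟩ := Finset.mem_map.1 hu
    rcases known_succ P e inp rounds hin hN t v with h | h
    · exact Or.inl h
    · right
      rw [h]
      refine ⟨Or.inl (Or.inl rfl), ?_⟩
      rintro w (rfl | hw) r hr
      · exact Or.inl (Or.inr hr)
      · obtain ⟨w', hw', rfl⟩ := (ofGraph_adj).1 hw
        exact Or.inr ⟨w', hw', hr⟩

theorem result_of_settled [Fintype V] {D : Set V} {N : ℕ}
    (hin : ∀ v, (inp v).inD = true ↔ v ∈ D) (hN : ∀ v, rounds (inp v) = N) {t : ℕ} {v : V}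
    (hs : Settled N (known P e inp rounds t (e v)) (e v)) :
    ((gossipAlgorithm rounds).result P e inp t v).isSome ∧
      ((gossipAlgorithm rounds).result P e inp t v = some true ↔
        e v ∈ (ofGraph e G D).selection (Finset.univ.map e) N) := by
  have hg := isGossip P e inp rounds hin hN
  have hv : e v ∈ Finset.univ.map e := by simp
  have hm := hg.models t _ hv
  have hid := run_ident_input P e inp rounds t v
  have hsol : (∃ J : Network, J.Models (known P e inp rounds t (e v)) ∧
      e v ∈ clusterSolution (J.view N (J.leader N (e v)))) ↔
      e v ∈ (ofGraph e G D).selection (Finset.univ.map e) N := by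
    rw [selection, Finset.mem_filter, and_iff_right hv]
    constructor
    · rintro ⟨J, hJ, h⟩
      obtain ⟨h1, h2, -⟩ :=
        (history_congr_iff.1 (hg.history_eq_of_settled hv hs hJ)).2 N le_rfl
      rwa [h1, h2] at h
    · exact fun h => ⟨_, hm, h⟩
  rw [known_apply] at hs hsol
  have h := output_of_settled rounds ((gossipAlgorithm rounds).run P e inp t v)
  rw [hid.1, hid.2, hN] at h
  exact ⟨(h hs).1, (h hs).2.trans hsol⟩

end gossipAlgorithm

theorem mainTheorem4 (C : ∀ V : Type u, SimpleGraph V → Prop) (hC : HasSubLogExpansion C) :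
    ∃ A : LocalAlgorithm NodeInput Bool,
      ∀ (c ε : ℝ), 0 < c → 0 < ε → ∀ k : ℕ, ∃ K : ℕ,
        ∀ (V : Type u) [Fintype V] [DecidableEq V] (G : SimpleGraph V), C V G →
        ∀ (P : PortNumbering G) (ident : V → ℕ), Function.Injective ident →
          (∀ v, ident v ≤ Fintype.card V ^ k) →
        ∀ D : Finset V, IsApproxMDS G c D →
          ∃ t : ℕ, t ≤ K * (logStar (Fintype.card V) + 1) ∧
            (∀ v, (A.result P ident (fun v => ⟨decide (v ∈ D), c, ε⟩) t v).isSome) ∧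
            IsApproxMDS G (1 + ε)
              (Finset.univ.filter fun v =>
                A.result P ident (fun v => ⟨decide (v ∈ D), c, ε⟩) t v = some true) := by
  obtain ⟨f, hf, hfC⟩ := hC
  have hN : ∀ c ε : ℝ, ∃ N : ℕ, 0 < c → 0 < ε →
      (∏ j ∈ Finset.range N, (1 - 1 / (16 * max 1 (f (4 ^ j) : ℝ)))) *
        (4 * max 1 (f (4 ^ 0) : ℝ) * c) ≤ ε := by
    intro c ε
    by_cases hε : 0 < ε
    · have h1 := (tendsto_prod_one_sub_of_isLittleO hf).mul_const
        (4 * max 1 (f (4 ^ 0) : ℝ) * c)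
      rw [zero_mul] at h1
      obtain ⟨N, hN⟩ := (h1.eventually (ge_mem_nhds hε)).exists
      exact ⟨N, fun _ _ => hN⟩
    · exact ⟨0, fun _ h => absurd h hε⟩
  choose N hN using hN
  refine ⟨gossipAlgorithm fun inp => N inp.factor inp.eps, fun c ε hc hε k =>
    ⟨2 + ∑ j ∈ Finset.range (N c ε + 1), (8 * k + 18) * (1 + 2 * 4 ^ j), ?_⟩⟩
  intro V _ _ G hG P ident hinj hident D hD
  set e : V ↪ ℕ := ⟨ident, hinj⟩
  set inp : V → NodeInput := fun v => ⟨decide (v ∈ D), c, ε⟩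
  set I := Network.ofGraph e G (D : Set V)
  set U := (Finset.univ : Finset V).map e
  have hin : ∀ v, (inp v).inD = true ↔ v ∈ (D : Set V) := by simp [inp]
  have hg := gossipAlgorithm.isGossip P e inp (fun inp => N inp.factor inp.eps) hin
    (fun v => (rfl : _ = N c ε))
  have hlevel : ∀ u ∈ U, level u ≤ logStar (Fintype.card V) + k := by
    intro u hu
    obtain ⟨v, -, rfl⟩ := Finset.mem_map.1 hu
    exact level_le_logStar_add (hident v)
  -- two rounds for the stars, then `8 * L + 10` phases of length `1 + 2 * 4 ^ j` per merging round,
  -- where `L = log* n + k` bounds the levels of the identifiers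
  set T := 2 + ∑ j ∈ Finset.range (N c ε + 1),
    (8 * (logStar (Fintype.card V) + k) + 10) * (1 + 2 * 4 ^ j)
  have hres := fun v : V => gossipAlgorithm.result_of_settled P e inp
    (fun inp => N inp.factor inp.eps) hin (fun v => (rfl : _ = N c ε)) (t := T)
    (hg.settled hlevel (show e v ∈ U by simp [U]))
  refine ⟨T, ?_, fun v => (hres v).1, ?_⟩
  · rw [add_mul, Finset.sum_mul]
    refine Nat.add_le_add (by omega) (Finset.sum_le_sum fun j _ => ?_)
    rw [mul_right_comm]
    exact Nat.mul_le_mul_right _ (by nlinarith)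
  set S := Finset.univ.filter fun v => (gossipAlgorithm fun inp => N inp.factor inp.eps).result P
    ident inp T v = some true
  have hS : ∀ v, v ∈ S ↔ e v ∈ I.selection U (N c ε) := fun v =>
    (Finset.mem_filter_univ v).trans (hres v).2
  have hcard : S.card = (I.selection U (N c ε)).card := by
    rw [← Finset.card_map e]
    congr 1
    ext u
    rw [Finset.mem_map]
    constructor
    · rintro ⟨v, hv, rfl⟩
      exact (hS v).1 hv
    · intro hu
      obtain ⟨v, -, rfl⟩ := Finset.mem_map.1 (Finset.mem_filter.1 hu).1
      exact ⟨v, (hS v).2 hu, rfl⟩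
  constructor
  · intro v
    obtain ⟨u, hu, huv⟩ := Network.exists_mem_selection hg.adj_mem (N c ε)
      (show e v ∈ U by simp [U])
    rcases huv with rfl | h
    · exact Or.inl ((hS v).2 hu)
    · obtain ⟨w, hw, rfl⟩ := (Network.ofGraph_adj).1 h.symm
      exact Or.inr ⟨w, (hS w).2 hu, hw.symm⟩
  obtain ⟨O, hO, hOcard⟩ : ∃ O : Finset V, IsDominatingSet G O ∧ O.card = domNumber G :=
    Nat.sInf_mem (s := {m | ∃ D : Finset V, IsDominatingSet G D ∧ D.card = m}) ⟨_, D, hD.1, rfl⟩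
  have hdom : ∀ B : Finset V, IsDominatingSet G B →
      ∀ u ∈ U, ∃ o ∈ B.map e, o = u ∨ I.graph.Adj o u := by
    intro B hB u hu
    obtain ⟨v, -, rfl⟩ := Finset.mem_map.1 hu
    rcases hB v with h | ⟨w, hw, h⟩
    · exact ⟨_, Finset.mem_map_of_mem e h, Or.inl rfl⟩
    · exact ⟨_, Finset.mem_map_of_mem e hw, Or.inr ((Network.ofGraph_adj).2
        ⟨v, h, rfl⟩)⟩
  have h1 := Network.card_selection_le hg.adj_mem (N c ε) (hdom O hO)
  rw [Finset.card_map, hOcard] at h1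
  have hsparse : I.IsSparse U fun i => max 1 (f (4 ^ i) : ℝ) :=
    Network.isSparse_ofGraph e G D fun i => (hfC V G hG _).trans (le_max_right _ _)
  have h2 := Network.card_crossing_le hg.adj_mem hsparse (fun i => le_max_left _ _) (N c ε)
  have hlead : (I.leaders U 0).card ≤ D.card := by
    rw [← Finset.card_map e]
    refine Finset.card_le_card fun x hx => ?_
    obtain ⟨u, hu, rfl⟩ := Finset.mem_image.1 hx
    have hmarked : ∀ o, o ∈ D.map e ↔ o ∈ I.marked := by
      intro o
      rw [← Finset.mem_coe, Finset.coe_map]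
      rfl
    rw [hmarked]
    obtain ⟨o, ho, hou⟩ := hdom D hD.1 u hu
    rw [hmarked] at ho
    rcases hou with rfl | h
    · exact I.star_mem (Or.inl ho)
    · exact I.star_mem (Or.inr ⟨o, ho, h.symm⟩)
  have h3 : ((I.crossing U (N c ε)).card : ℝ) ≤ ε * domNumber G := by
    have hprod : 0 ≤ ∏ j ∈ Finset.range (N c ε), (1 - 1 / (16 * max 1 (f (4 ^ j) : ℝ))) :=
      Finset.prod_nonneg fun j _ => by
        have : (1 : ℝ) ≤ max 1 (f (4 ^ j) : ℝ) := le_max_left _ _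
        rw [sub_nonneg, div_le_one (by positivity)]
        linarith
    have hle : ((I.leaders U 0).card : ℝ) ≤ c * domNumber G :=
      (Nat.cast_le.2 hlead).trans hD.2
    calc ((I.crossing U (N c ε)).card : ℝ) ≤ _ := h2
      _ ≤ (∏ j ∈ Finset.range (N c ε), (1 - 1 / (16 * max 1 (f (4 ^ j) : ℝ)))) *
          (4 * max 1 (f (4 ^ 0) : ℝ) * (c * domNumber G)) := by gcongr
      _ = (∏ j ∈ Finset.range (N c ε), (1 - 1 / (16 * max 1 (f (4 ^ j) : ℝ)))) *
          (4 * max 1 (f (4 ^ 0) : ℝ) * c) * domNumber G := by ring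
      _ ≤ ε * domNumber G := by
          gcongr
          exact hN c ε hc hε
  have h4 : (S.card : ℝ) ≤ domNumber G + (I.crossing U (N c ε)).card := by
    rw [hcard]
    exact_mod_cast h1
  linarith
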